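/- **Setting.** Let $n,m\ge 1$ and let $G=\mathbb R^{2n}\times\mathbb R^m$ be an H-type group: $\mathbb R^{2n}\times\mathbb R^m$ carries its Euclidean inner product and a Lie bracket $[(x,z),(x',z')]=(0,[x,x'])$ with centre $0\times\mathbb R^m$ such that $[\mathbb R^{2n},\mathbb R^{2n}]$ spans $\mathbb R^m$ and, for every $z\in\mathbb R^m$ with $|z|=1$, the map $J_z$ on $\mathbb R^{2n}$ defined by $\langle J_zx,y\rangle=\langle z,[x,y]\rangle$ is orthogonal. The group law is $v\star w=v+w+\frac12[v,w]$. For $1\le i\le 2n$ put $$X_if(g)=\tfrac{d}{ds}\big|_{s=0}f(g\star(se_i,0)),\qquad \hat X_if(g)=\tfrac{d}{ds}\big|_{s=0}f((se_i,0)\star g),$$ $\nabla f=(X_1f,\dots,X_{2n}f)$, $\hat\nabla f=(\hat X_1f,\dots,\hat X_{2n}f)$ and $L=X_1^2+\dots+X_{2n}^2$. Let $d$ be the Carnot–Carathéodory distance, i.e. $d(g,h)$ is the infimum of $\int_0^1|a(s)|\,ds$ over absolutely continuous paths $\gamma:[0,1]\to G$ from $g$ to $h$ with $\dot\gamma(s)=\sum_i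 a_i(s)X_i(\gamma(s))$ for almost every $s$, where $a_1,\dots,a_{2n}$ are absolutely continuous. Let $\mathcal C$ be the class of $f\in C^1(G)$ for which there are $M,a\ge0$ and $\epsilon\in(0,1)$ with $$|f(g)|+|\nabla f(g)|+|\hat\nabla f(g)|\le M e^{a\,d(0,g)^{2-\epsilon}}\qquad\text{for all } g\in G.$$ For $t>0$ let $$p_t(x,z)=(2\pi)^{-m}(4\pi)^{-n}\int_{\mathbb R^m}e^{i\langle\lambda,z\rangle-\frac14|\lambda|\coth(t|\lambda|)|x|^2}\Big(\frac{|\lambda|}{\sinh(t|\lambda|)}\Big)^n d\lambda$$ be the heat kernel of $L$ (the convolution kernel of $e^{tL}$), let $P_tf(g)=\int_G f(g\star k)\,p_t(k)\,dk$ with respect to Lebesgue measure, and let $P_0f=f$. For $t\ge0$ define, as a supremum in the extended real line, $$K_{\mathrm{opt}}(t)=\sup\left\{\frac{|(\nabla P_tf)(g)|}{P_t(|\nabla f|)(g)}\ :\ f\in\mathcal C,\ g\in G,\ P_t(|\nabla f|)(g)\ne0\right\}.$$ **Proposition.** $K_{\mathrm{opt}}(0)=1$. There is a single value $K_{\mathrm{opt}}>1$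 with $K_{\mathrm{opt}}(t)=K_{\mathrm{opt}}$ for every $t>0$, and it satisfies $$K_{\mathrm{opt}}\ \ge\ \sqrt{\frac{3n+5}{3n+1}}.$$ In particular, $t\mapsto K_{\mathrm{opt}}(t)$, $t\ge 0$, is discontinuous at $t=0$. -/

import Mathlib

open MeasureTheory Set Filter Topology
open scoped RealInnerProductSpace

noncomputable section

namespace HType

/-- The horizontal layer `ℝ²ⁿ` (the orthogonal complement of the centre). -/
abbrev Hor (n : ℕ) := EuclideanSpace ℝ (Fin (2 * n))

/-- The centre `ℝᵐ`. -/
abbrev Ver (m : ℕ) := EuclideanSpace ℝ (Fin m)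

/-- The underlying space `ℝ²ⁿ⁺ᵐ = ℝ²ⁿ × ℝᵐ` of the group; its `volume` is Lebesgue measure. -/
abbrev Grp (n m : ℕ) := Hor n × Ver m

/-- The map `J_z : ℝ²ⁿ → ℝ²ⁿ` attached to a bilinear map `β : ℝ²ⁿ × ℝ²ⁿ → ℝᵐ`, determined by
`⟪J_z x, y⟫ = ⟪z, β x y⟫` (see `inner_J`). -/
def J {n m : ℕ} (β : Hor n →ₗ[ℝ] Hor n →ₗ[ℝ] Ver m) (z : Ver m) (x : Hor n) : Hor n :=
  LinearMap.adjoint (β x) z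

theorem inner_J {n m : ℕ} (β : Hor n →ₗ[ℝ] Hor n →ₗ[ℝ] Ver m) (z : Ver m) (x y : Hor n) :
    ⟪J β z x, y⟫ = ⟪z, β x y⟫ := by
  unfold J
  rw [LinearMap.adjoint_inner_left]

/-- An H-type Lie algebra structure on `ℝ²ⁿ × ℝᵐ`, with its Euclidean inner product and centre
`0 × ℝᵐ`: the Lie bracket is `[(x, z), (x', z')] = (0, bracket x x')`. -/
structure HTypeAlgebra (n m : ℕ) where
  /-- the bracket of two horizontal vectors -/
  bracket : Hor n →ₗ[ℝ] Hor n →ₗ[ℝ] Ver m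
  bracket_self : ∀ x, bracket x x = 0
  /-- `[𝔷ᗮ, 𝔷ᗮ] = 𝔷` -/
  span_bracket : Submodule.span ℝ {z | ∃ x y, bracket x y = z} = ⊤
  /-- `J_z` is orthogonal for `|z| = 1` -/
  orthogonal_J : ∀ z : Ver m, ‖z‖ = 1 → ∀ x, ‖J bracket z x‖ = ‖x‖

variable {n m : ℕ}

/-- The group law `v ⋆ w = v + w + ½ [v, w]`. -/
def mul (B : HTypeAlgebra n m) (g h : Grp n m) : Grp n m :=
  (g.1 + h.1, g.2 + h.2 + (1 / 2 : ℝ) • B.bracket g.1 h.1)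

/-- The element `(s eᵢ, 0)`. -/
def hvec (m : ℕ) (i : Fin (2 * n)) (s : ℝ) : Grp n m := (EuclideanSpace.single i s, 0)

/-- The left-invariant field `Xᵢ` as a derivation: `Xᵢ f (g) = d/ds|₀ f (g ⋆ (s eᵢ, 0))`. -/
def X (B : HTypeAlgebra n m) (i : Fin (2 * n)) (f : Grp n m → ℝ) (g : Grp n m) : ℝ :=
  deriv (fun s : ℝ => f (mul B g (hvec m i s))) 0

/-- The right-invariant field `X̂ᵢ` as a derivation: `X̂ᵢ f (g) = d/ds|₀ f ((s eᵢ, 0) ⋆ g)`. -/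
def XHat (B : HTypeAlgebra n m) (i : Fin (2 * n)) (f : Grp n m → ℝ) (g : Grp n m) : ℝ :=
  deriv (fun s : ℝ => f (mul B (hvec m i s) g)) 0

/-- The subgradient `∇ f = (X₁ f, …, X₂ₙ f)`. -/
def grad (B : HTypeAlgebra n m) (f : Grp n m → ℝ) (g : Grp n m) : Hor n :=
  WithLp.toLp 2 fun i => X B i f g

/-- The right-invariant subgradient `∇̂ f = (X̂₁ f, …, X̂₂ₙ f)`. -/
def gradHat (B : HTypeAlgebra n m) (f : Grp n m → ℝ) (g : Grp n m) : Hor n :=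
  WithLp.toLp 2 fun i => XHat B i f g

/-- The sublaplacian `L = X₁² + ⋯ + X₂ₙ²`. -/
def sublaplacian (B : HTypeAlgebra n m) (f : Grp n m → ℝ) (g : Grp n m) : ℝ :=
  ∑ i, X B i (X B i f) g

/-- The tangent vector `Xᵢ(g) ∈ T_g G = ℝ²ⁿ × ℝᵐ`. -/
def XVec (B : HTypeAlgebra n m) (i : Fin (2 * n)) (g : Grp n m) : Grp n m :=
  (EuclideanSpace.single i 1, (1 / 2 : ℝ) • B.bracket g.1 (EuclideanSpace.single i 1))

/-- `γ : [0,1] → G` is a horizontal path with coefficients `a`: both are absolutely continuous and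
`γ'(s) = ∑ᵢ aᵢ(s) Xᵢ(γ(s))` for almost every `s ∈ [0,1]`. -/
def IsHorizontal (B : HTypeAlgebra n m) (γ : ℝ → Grp n m) (a : ℝ → Hor n) : Prop :=
  AbsolutelyContinuousOnInterval γ 0 1 ∧ AbsolutelyContinuousOnInterval a 0 1 ∧
    ∀ᵐ s : ℝ, s ∈ Icc (0 : ℝ) 1 → HasDerivAt γ (∑ i, a s i • XVec B i (γ s)) s

/-- The Carnot–Carathéodory distance. -/
def ccDist (B : HTypeAlgebra n m) (g h : Grp n m) : ℝ :=
  sInf {l : ℝ | ∃ (γ : ℝ → Grp n m) (a : ℝ → Hor n), IsHorizontal B γ a ∧ γ 0 = g ∧ γ 1 = h ∧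
    l = ∫ s in (0 : ℝ)..1, ‖a s‖}

/-- The class `𝒞` of admissible functions. -/
def ClassC (B : HTypeAlgebra n m) : Set (Grp n m → ℝ) :=
  {f | ContDiff ℝ 1 f ∧ ∃ M a ε : ℝ, 0 ≤ M ∧ 0 ≤ a ∧ 0 < ε ∧ ε < 1 ∧ ∀ g,
    |f g| + ‖grad B f g‖ + ‖gradHat B f g‖ ≤ M * Real.exp (a * ccDist B 0 g ^ (2 - ε))}

/-- The hyperbolic cotangent. -/
def coth (y : ℝ) : ℝ := Real.cosh y / Real.sinh y

/-- The integrand of the heat kernel. -/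
def kernelIntegrand (t : ℝ) (g : Grp n m) (l : Ver m) : ℂ :=
  Complex.exp (Complex.I * ((⟪l, g.2⟫ : ℝ) : ℂ)
      - ((1 / 4 * (‖l‖ * coth (t * ‖l‖)) * ‖g.1‖ ^ 2 : ℝ) : ℂ))
    * (((‖l‖ / Real.sinh (t * ‖l‖)) ^ n : ℝ) : ℂ)

/-- The heat kernel `p_t`, the convolution kernel of `e^{tL}` for `t > 0`:
`p_t(x,z) = (2π)⁻ᵐ (4π)⁻ⁿ ∫ e^{i⟨λ,z⟩ - ¼ |λ| coth(t|λ|) |x|²} (|λ| / sinh(t|λ|))ⁿ dλ`.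
The imaginary part of the integral vanishes, by the symmetry `λ ↦ -λ`.
See `hasDerivAt_heatKernel` for the heat equation `∂ₜ p_t = L p_t`. -/
def heatKernel (t : ℝ) (g : Grp n m) : ℝ :=
  ((2 * Real.pi) ^ m)⁻¹ * ((4 * Real.pi) ^ n)⁻¹ * (∫ l : Ver m, kernelIntegrand t g l).re

/-- The heat semigroup: `P_t f (g) = ∫ f (g ⋆ k) p_t(k) dk` for `t > 0`, and `P_0 f = f`. -/
def heat (B : HTypeAlgebra n m) (t : ℝ) (f : Grp n m → ℝ) (g : Grp n m) : ℝ :=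
  if t = 0 then f g else ∫ k : Grp n m, f (mul B g k) * heatKernel t k

/-- The optimal constant at time `t`: the supremum, in the extended reals, of the ratios
`|∇ P_t f|(g) / P_t(|∇ f|)(g)` over `f ∈ 𝒞` and `g` with `P_t(|∇ f|)(g) ≠ 0`. -/
def Kopt (B : HTypeAlgebra n m) (t : ℝ) : EReal :=
  sSup {r : EReal | ∃ f ∈ ClassC B, ∃ g : Grp n m, heat B t (fun k => ‖grad B f k‖) g ≠ 0 ∧
    r = ((‖grad B (heat B t f) g‖ / heat B t (fun k => ‖grad B f k‖) g : ℝ) : EReal)}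


theorem sinh_weight_bound {t₀ : ℝ} (ht₀ : 0 < t₀) (N : ℕ) : ∃ C : ℝ, 0 ≤ C ∧
    ∀ t r : ℝ, t₀ ≤ t → 0 ≤ r → (1 + r) ^ N * (r / Real.sinh (t * r)) ≤ C := by
  refine ⟨2 ^ N / t₀ + 2 ^ N * (2 * N + 1).factorial / t₀ ^ (2 * N + 1), by positivity, ?_⟩
  intro t r ht hr
  rcases hr.eq_or_lt with rfl | hr0
  · simp; positivity
  have htr : 0 < t₀ * r := by positivity
  have hw : 0 ≤ r / Real.sinh (t * r) :=
    div_nonneg hr (Real.sinh_nonneg_iff.2 (mul_nonneg (ht₀.le.trans ht) hr))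
  have hle : Real.sinh (t₀ * r) ≤ Real.sinh (t * r) :=
    Real.sinh_le_sinh.2 (mul_le_mul_of_nonneg_right ht hr)
  have h1 : t₀ * r ≤ Real.sinh (t₀ * r) := Real.self_le_sinh_iff.2 htr.le
  have h2 : (t₀ * r) ^ (2 * N + 1) / (2 * N + 1).factorial ≤ Real.sinh (t₀ * r) :=
    le_hasSum (Real.hasSum_sinh (t₀ * r)) N (fun j _ => by positivity)
  by_cases hr1 : r ≤ 1
  · calc (1 + r) ^ N * (r / Real.sinh (t * r)) ≤ 2 ^ N * (r / (t₀ * r)) := by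
          gcongr
          · linarith
          · exact h1.trans hle
      _ = 2 ^ N / t₀ := by field_simp
      _ ≤ _ := le_add_of_nonneg_right (by positivity)
  · have hr1 : 1 ≤ r := by linarith
    calc (1 + r) ^ N * (r / Real.sinh (t * r))
        ≤ (2 * r) ^ N * (r / ((t₀ * r) ^ (2 * N + 1) / (2 * N + 1).factorial)) := by
          gcongr
          · linarith
          · exact h2.trans hle
      _ = 2 ^ N * (2 * N + 1).factorial / t₀ ^ (2 * N + 1) * (r ^ (N + 1) / r ^ (2 * N + 1)) := by
          rw [mul_pow, mul_pow, pow_succ r N]; field_simp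
      _ ≤ 2 ^ N * (2 * N + 1).factorial / t₀ ^ (2 * N + 1) * 1 := by
          gcongr
          exact div_le_one_of_le₀ (pow_le_pow_right₀ hr1 (by omega)) (by positivity)
      _ ≤ _ := by
          rw [mul_one]; exact le_add_of_nonneg_left (by positivity)

theorem sinh_weight_nonneg {t r : ℝ} (ht : 0 < t) (hr : 0 ≤ r) : 0 ≤ r / Real.sinh (t * r) :=
  div_nonneg hr (Real.sinh_nonneg_iff.2 (by positivity))

theorem integrable_bound (hn : 0 < n) {t₀ : ℝ} (ht₀ : 0 < t₀) (j : ℕ) :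
    ∃ b : Ver m → ℝ, Integrable b ∧ ∀ t, t₀ ≤ t → ∀ l : Ver m,
      (1 + ‖l‖) ^ j * (‖l‖ / Real.sinh (t * ‖l‖)) ^ n ≤ b l := by
  obtain ⟨C, hC, h⟩ := sinh_weight_bound ht₀ (j + (m + 1))
  refine ⟨fun l => C ^ n * (1 + ‖l‖) ^ (-((m + 1 : ℕ) : ℝ)), ?_, ?_⟩
  · apply Integrable.const_mul
    apply integrable_one_add_norm
    simp
  · intro t ht l
    have h0 := norm_nonneg l
    have hw := sinh_weight_nonneg (ht₀.trans_le ht) h0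
    have hb := h t ‖l‖ ht h0
    set w := ‖l‖ / Real.sinh (t * ‖l‖)
    show _ ≤ C ^ n * (1 + ‖l‖) ^ (-((m + 1 : ℕ) : ℝ))
    rw [Real.rpow_neg (by positivity), Real.rpow_natCast, ← div_eq_mul_inv,
      le_div_iff₀ (by positivity)]
    calc (1 + ‖l‖) ^ j * w ^ n * (1 + ‖l‖) ^ (m + 1) = (1 + ‖l‖) ^ (j + (m + 1)) * w ^ n := by
          rw [pow_add]; ring
      _ ≤ ((1 + ‖l‖) ^ (j + (m + 1))) ^ n * w ^ n := by
          gcongr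
          exact le_self_pow₀ (one_le_pow₀ (by linarith)) hn.ne'
      _ = ((1 + ‖l‖) ^ (j + (m + 1)) * w) ^ n := by rw [mul_pow]
      _ ≤ C ^ n := by gcongr

theorem coth_weight_bound {t r : ℝ} (ht : 0 < t) (hr : 0 ≤ r) :
    0 ≤ r * coth (t * r) ∧ r * coth (t * r) ≤ r + 1 / t := by
  rcases hr.eq_or_lt with rfl | hr0
  · simp; positivity
  have htr : 0 < t * r := by positivity
  have hs : 0 < Real.sinh (t * r) := Real.sinh_pos_iff.2 htr
  have h1 : t * r ≤ Real.sinh (t * r) := Real.self_le_sinh_iff.2 htr.le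
  refine ⟨mul_nonneg hr (div_nonneg (Real.cosh_pos _).le hs.le), ?_⟩
  have h2 : Real.cosh (t * r) - Real.sinh (t * r) ≤ 1 := by
    rw [Real.cosh_sub_sinh]
    exact Real.exp_le_one_iff.2 (by linarith)
  unfold coth
  rw [← mul_div_assoc, div_le_iff₀ hs]
  have h3 : (r + 1 / t) * Real.sinh (t * r) = r * Real.sinh (t * r) + Real.sinh (t * r) / t := by
    ring
  have h4 : r ≤ Real.sinh (t * r) / t := by
    rw [le_div_iff₀ ht]; linarith
  rw [h3]
  nlinarith

theorem norm_kernelIntegrand_le {t : ℝ} (ht : 0 < t) (g : Grp n m) (l : Ver m) :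
    ‖kernelIntegrand t g l‖ ≤ (‖l‖ / Real.sinh (t * ‖l‖)) ^ n := by
  have hw := sinh_weight_nonneg ht (norm_nonneg l)
  have hc := (coth_weight_bound ht (norm_nonneg l)).1
  unfold kernelIntegrand
  rw [norm_mul, Complex.norm_exp, Complex.norm_real, Real.norm_of_nonneg (pow_nonneg hw n)]
  apply mul_le_of_le_one_left (pow_nonneg hw n)
  rw [Real.exp_le_one_iff]
  simp only [Complex.sub_re, Complex.mul_re, Complex.I_re, Complex.I_im, Complex.ofReal_re,
    Complex.ofReal_im]
  have : 0 ≤ 1 / 4 * (‖l‖ * coth (t * ‖l‖)) * ‖g.1‖ ^ 2 := by positivity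
  linarith

theorem measurable_kernelIntegrand (t : ℝ) (g : Grp n m) :
    Measurable (fun l : Ver m => kernelIntegrand t g l) := by
  unfold kernelIntegrand coth
  fun_prop

theorem integrable_kernelIntegrand (hn : 0 < n) {t : ℝ} (ht : 0 < t) (g : Grp n m) :
    Integrable (fun l : Ver m => kernelIntegrand t g l) := by
  obtain ⟨b, hb, h⟩ := integrable_bound (n := n) (m := m) hn ht 0
  refine hb.mono' (measurable_kernelIntegrand t g).aestronglyMeasurable (.of_forall fun l => ?_)
  have := h t le_rfl l
  rw [pow_zero, one_mul] at this
  exact (norm_kernelIntegrand_le ht g l).trans this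

/-- The kernel integrand with its exponent written out along the curve `s ↦ g ⋆ (s eᵢ, 0)`. -/
theorem kernelIntegrand_mul_hvec (B : HTypeAlgebra n m) (t : ℝ) (g : Grp n m) (i : Fin (2 * n))
    (l : Ver m) (s : ℝ) : kernelIntegrand t (mul B g (hvec m i s)) l =
      Complex.exp (Complex.I * (⟪l, g.2⟫ + s * (1 / 2 * ⟪J B.bracket l g.1,
        EuclideanSpace.single i 1⟫) : ℝ) - (1 / 4 * (‖l‖ * coth (t * ‖l‖)) *
          (‖g.1‖ ^ 2 + 2 * s * g.1 i + s ^ 2) : ℝ))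
      * (((‖l‖ / Real.sinh (t * ‖l‖)) ^ n : ℝ) : ℂ) := by
  have hs : (EuclideanSpace.single i s : Hor n) = s • EuclideanSpace.single i (1 : ℝ) := by
    ext j; simp
  have h1 : ⟪l, (mul B g (hvec m i s)).2⟫ = ⟪l, g.2⟫ + s * (1 / 2 * ⟪J B.bracket l g.1,
        EuclideanSpace.single i 1⟫) := by
    rw [inner_J]
    simp only [mul, hvec, hs, add_zero, map_smul, inner_add_right, inner_smul_right]
    ring
  have h2 : ‖(mul B g (hvec m i s)).1‖ ^ 2 = ‖g.1‖ ^ 2 + 2 * s * g.1 i + s ^ 2 := by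
    simp only [mul, hvec]
    rw [norm_add_sq_real]
    simp only [EuclideanSpace.inner_single_right, PiLp.norm_single, Real.norm_eq_abs,
      sq_abs]
    simp
    ring
  unfold kernelIntegrand
  rw [h1, h2]

theorem mul_hvec_hvec (B : HTypeAlgebra n m) (g : Grp n m) (i : Fin (2 * n)) (s s' : ℝ) :
    mul B (mul B g (hvec m i s)) (hvec m i s') = mul B g (hvec m i (s + s')) := by
  have hs : ∀ s : ℝ, (EuclideanSpace.single i s : Hor n) = s • EuclideanSpace.single i (1 : ℝ) := by
    intro s; ext j; simp
  simp only [mul, hvec, hs s, hs s', hs (s + s'), add_zero]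
  refine Prod.ext ?_ ?_
  · simp only [add_smul, add_assoc]
  · simp only [map_add, map_smul, LinearMap.add_apply, LinearMap.smul_apply, B.bracket_self,
      smul_zero, add_zero, add_smul, smul_add, add_assoc]

/-- The logarithmic derivative of the integrand along `s ↦ g ⋆ (s eᵢ, 0)`. -/
def logDer (B : HTypeAlgebra n m) (t : ℝ) (g : Grp n m) (i : Fin (2 * n)) (l : Ver m) (s : ℝ) : ℂ :=
  Complex.I * (1 / 2 * ⟪J B.bracket l g.1, EuclideanSpace.single i 1⟫ : ℝ)
    - (1 / 2 * (‖l‖ * coth (t * ‖l‖)) * (g.1 i + s) : ℝ)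

theorem hasDerivAt_logDer (B : HTypeAlgebra n m) (t : ℝ) (g : Grp n m) (i : Fin (2 * n))
    (l : Ver m) (s : ℝ) :
    HasDerivAt (logDer B t g i l) (-(1 / 2 * (‖l‖ * coth (t * ‖l‖)) : ℝ)) s := by
  unfold logDer
  have h : HasDerivAt (fun s : ℝ => 1 / 2 * (‖l‖ * coth (t * ‖l‖)) * (g.1 i + s))
      (1 / 2 * (‖l‖ * coth (t * ‖l‖)) * 1) s := ((hasDerivAt_id s).const_add _).const_mul _
  rw [mul_one] at h
  exact h.ofReal_comp.const_sub _

theorem hasDerivAt_kernelIntegrand_curve (B : HTypeAlgebra n m) (t : ℝ) (g : Grp n m)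
    (i : Fin (2 * n)) (l : Ver m) (s : ℝ) :
    HasDerivAt (fun s => kernelIntegrand t (mul B g (hvec m i s)) l)
      (logDer B t g i l s * kernelIntegrand t (mul B g (hvec m i s)) l) s := by
  simp only [kernelIntegrand_mul_hvec]
  have h1 : HasDerivAt (fun s : ℝ => ⟪l, g.2⟫ + s * (1 / 2 * ⟪J B.bracket l g.1,
      EuclideanSpace.single i 1⟫)) (1 * (1 / 2 * ⟪J B.bracket l g.1,
      EuclideanSpace.single i 1⟫)) s := ((hasDerivAt_id s).mul_const _).const_add _
  have h2 : HasDerivAt (fun s : ℝ => 1 / 4 * (‖l‖ * coth (t * ‖l‖)) *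
      (‖g.1‖ ^ 2 + 2 * s * g.1 i + s ^ 2))
      (1 / 4 * (‖l‖ * coth (t * ‖l‖)) * (2 * 1 * g.1 i + 2 * s)) s := by
    have h3 : HasDerivAt (fun s : ℝ => ‖g.1‖ ^ 2 + 2 * s * g.1 i + s ^ 2)
        (2 * 1 * g.1 i + 2 * s) s := by
      have := ((((hasDerivAt_id s).const_mul 2).mul_const (g.1 i)).const_add (‖g.1‖ ^ 2)).add
        (hasDerivAt_pow 2 s)
      refine this.congr_deriv ?_
      norm_num
    exact h3.const_mul _
  have h := (((h1.ofReal_comp.const_mul Complex.I).sub h2.ofReal_comp).cexp).mul_const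
    (((‖l‖ / Real.sinh (t * ‖l‖)) ^ n : ℝ) : ℂ)
  refine h.congr_deriv ?_
  unfold logDer
  push_cast
  simp only [Pi.sub_apply]
  ring

theorem norm_logDer_le (B : HTypeAlgebra n m) {t : ℝ} (ht : 0 < t) (g : Grp n m) (i : Fin (2 * n)) :
    ∃ D : ℝ, 0 ≤ D ∧ ∀ l s, |s| ≤ 1 → ‖logDer B t g i l s‖ ≤ D * (1 + ‖l‖) ∧
      ‖logDer B t g i l s * logDer B t g i l s - (1 / 2 * (‖l‖ * coth (t * ‖l‖)) : ℝ)‖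
        ≤ D * (1 + ‖l‖) ^ 2 := by
  set D₁ : ℝ := ‖B.bracket g.1 (EuclideanSpace.single i 1)‖ + (1 + 1 / t) * (|g.1 i| + 1)
  have hD₁ : 0 ≤ D₁ := by positivity
  have hc : ∀ l : Ver m, 0 ≤ ‖l‖ * coth (t * ‖l‖) ∧
      ‖l‖ * coth (t * ‖l‖) ≤ (1 + 1 / t) * (1 + ‖l‖) := by
    intro l
    have h := coth_weight_bound ht (norm_nonneg l)
    have h1 : 0 ≤ 1 / t := by positivity
    have h2 := norm_nonneg l
    exact ⟨h.1, h.2.trans (by nlinarith)⟩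
  have key : ∀ l s, |s| ≤ 1 → ‖logDer B t g i l s‖ ≤ D₁ * (1 + ‖l‖) := by
    intro l s hs
    unfold logDer
    refine (norm_sub_le _ _).trans ?_
    rw [norm_mul, Complex.norm_I, one_mul, Complex.norm_real, Complex.norm_real, inner_J,
      norm_mul, norm_mul, norm_mul, Real.norm_of_nonneg (hc l).1]
    have h1 := norm_inner_le_norm (𝕜 := ℝ) l (B.bracket g.1 (EuclideanSpace.single i 1))
    have h2 : ‖g.1 i + s‖ ≤ |g.1 i| + 1 := (norm_add_le _ _).trans (by
      simp only [Real.norm_eq_abs]; linarith)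
    have h3 : ‖l‖ * coth (t * ‖l‖) * ‖g.1 i + s‖ ≤ (1 + 1 / t) * (1 + ‖l‖) * (|g.1 i| + 1) := by
      have := (hc l).2
      have := (hc l).1
      gcongr
    have h4 : ‖(1 / 2 : ℝ)‖ = 1 / 2 := by norm_num
    rw [h4]
    have h5 : 0 ≤ ‖l‖ * coth (t * ‖l‖) * ‖g.1 i + s‖ := mul_nonneg (hc l).1 (norm_nonneg _)
    have h6 := norm_nonneg (B.bracket g.1 (EuclideanSpace.single i 1))
    have h7 := norm_nonneg ⟪l, B.bracket g.1 (EuclideanSpace.single i 1)⟫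
    simp only [D₁]
    nlinarith
  refine ⟨D₁ + D₁ ^ 2 + (1 + 1 / t), by positivity, fun l s hs => ⟨?_, ?_⟩⟩
  · refine (key l s hs).trans ?_
    gcongr
    have : 0 ≤ D₁ ^ 2 + (1 + 1 / t) := by positivity
    linarith
  · refine (norm_sub_le _ _).trans ?_
    rw [norm_mul, Complex.norm_real, norm_mul, Real.norm_of_nonneg (hc l).1]
    have h4 : ‖(1 / 2 : ℝ)‖ = 1 / 2 := by norm_num
    rw [h4]
    have h1 : ‖logDer B t g i l s‖ * ‖logDer B t g i l s‖ ≤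
        (D₁ * (1 + ‖l‖)) * (D₁ * (1 + ‖l‖)) := by
      have := key l s hs
      gcongr
    have h2 := (hc l).2
    have h2' := (hc l).1
    have h3 := norm_nonneg l
    have h5 : 0 ≤ (1 + 1 / t) * ‖l‖ := by positivity
    have h6 : 0 ≤ (1 + 1 / t) * ‖l‖ ^ 2 := by positivity
    have h7 : 0 ≤ D₁ * (1 + ‖l‖) ^ 2 := by positivity
    nlinarith

theorem measurable_logDer (B : HTypeAlgebra n m) (t : ℝ) (g : Grp n m) (i : Fin (2 * n)) (s : ℝ) :
    Measurable (fun l : Ver m => logDer B t g i l s) := by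
  unfold logDer coth
  simp only [inner_J]
  fun_prop

/-- First derivative of the integral along the curve. -/
theorem hasDerivAt_integral_curve (B : HTypeAlgebra n m) (hn : 0 < n) {t : ℝ} (ht : 0 < t)
    (g : Grp n m) (i : Fin (2 * n)) {s : ℝ} (hs : s ∈ Ioo (-1 : ℝ) 1) :
    HasDerivAt (fun s => ∫ l, kernelIntegrand t (mul B g (hvec m i s)) l)
      (∫ l, logDer B t g i l s * kernelIntegrand t (mul B g (hvec m i s)) l) s := by
  obtain ⟨D, hD, hq⟩ := norm_logDer_le B ht g i
  obtain ⟨b, hb, hbd⟩ := integrable_bound (n := n) (m := m) hn ht 1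
  refine (hasDerivAt_integral_of_dominated_loc_of_deriv_le (bound := fun l => D * b l)
    (Ioo_mem_nhds hs.1 hs.2) (.of_forall fun s =>
      (measurable_kernelIntegrand t _).aestronglyMeasurable)
    (integrable_kernelIntegrand hn ht _)
    ((measurable_logDer B t g i s).mul (measurable_kernelIntegrand t _)).aestronglyMeasurable
    (.of_forall fun l s' hs' => ?_) (hb.const_mul D)
    (.of_forall fun l s' _ => hasDerivAt_kernelIntegrand_curve B t g i l s')).2
  have h1 := (hq l s' (abs_le.2 ⟨hs'.1.le, hs'.2.le⟩)).1
  have h2 := norm_kernelIntegrand_le ht (mul B g (hvec m i s')) l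
  have h3 := hbd t le_rfl l
  rw [pow_one] at h3
  rw [norm_mul]
  have := norm_nonneg l
  calc _ ≤ D * (1 + ‖l‖) * (‖l‖ / Real.sinh (t * ‖l‖)) ^ n := by gcongr
    _ ≤ D * b l := by rw [mul_assoc]; gcongr

/-- Second derivative of the integral along the curve. -/
theorem hasDerivAt_integral_curve' (B : HTypeAlgebra n m) (hn : 0 < n) {t : ℝ} (ht : 0 < t)
    (g : Grp n m) (i : Fin (2 * n)) :
    Integrable (fun l => (logDer B t g i l 0 * logDer B t g i l 0
        - (1 / 2 * (‖l‖ * coth (t * ‖l‖)) : ℝ)) * kernelIntegrand t (mul B g (hvec m i 0)) l) ∧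
    HasDerivAt (fun s => ∫ l, logDer B t g i l s * kernelIntegrand t (mul B g (hvec m i s)) l)
      (∫ l, (logDer B t g i l 0 * logDer B t g i l 0
        - (1 / 2 * (‖l‖ * coth (t * ‖l‖)) : ℝ)) * kernelIntegrand t (mul B g (hvec m i 0)) l) 0 := by
  obtain ⟨D, hD, hq⟩ := norm_logDer_le B ht g i
  obtain ⟨b, hb, hbd⟩ := integrable_bound (n := n) (m := m) hn ht 1
  obtain ⟨b2, hb2, hbd2⟩ := integrable_bound (n := n) (m := m) hn ht 2
  have hmeas : ∀ s, Measurable (fun l =>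
      logDer B t g i l s * kernelIntegrand t (mul B g (hvec m i s)) l) := fun s =>
    (measurable_logDer B t g i s).mul (measurable_kernelIntegrand t _)
  have hc : Measurable (fun l : Ver m => (((1 / 2 * (‖l‖ * coth (t * ‖l‖)) : ℝ)) : ℂ)) := by
    unfold coth; fun_prop
  refine hasDerivAt_integral_of_dominated_loc_of_deriv_le (bound := fun l => D * b2 l)
    (F' := fun s l => (logDer B t g i l s * logDer B t g i l s
        - (1 / 2 * (‖l‖ * coth (t * ‖l‖)) : ℝ)) * kernelIntegrand t (mul B g (hvec m i s)) l)
    (s := Ioo (-1 : ℝ) 1)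
    (Ioo_mem_nhds (by norm_num) (by norm_num)) (.of_forall fun s => (hmeas s).aestronglyMeasurable)
    ?_ ?_ (.of_forall fun l s' hs' => ?_) (hb2.const_mul D) (.of_forall fun l s' _ => ?_)
  · refine (hb.const_mul D).mono' (hmeas 0).aestronglyMeasurable (.of_forall fun l => ?_)
    have h1 := (hq l 0 (by norm_num)).1
    have h2 := norm_kernelIntegrand_le ht (mul B g (hvec m i 0)) l
    have h3 := hbd t le_rfl l
    rw [pow_one] at h3
    rw [norm_mul]
    calc _ ≤ D * (1 + ‖l‖) * (‖l‖ / Real.sinh (t * ‖l‖)) ^ n := by gcongr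
      _ ≤ D * b l := by rw [mul_assoc]; gcongr
  · exact ((((measurable_logDer B t g i 0).mul (measurable_logDer B t g i 0)).sub hc).mul
      (measurable_kernelIntegrand t _)).aestronglyMeasurable
  · have h1 := (hq l s' (abs_le.2 ⟨hs'.1.le, hs'.2.le⟩)).2
    have h2 := norm_kernelIntegrand_le ht (mul B g (hvec m i s')) l
    have h3 := hbd2 t le_rfl l
    rw [norm_mul]
    calc _ ≤ D * (1 + ‖l‖) ^ 2 * (‖l‖ / Real.sinh (t * ‖l‖)) ^ n := by gcongr
      _ ≤ D * b2 l := by rw [mul_assoc]; gcongr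
  · refine ((hasDerivAt_logDer B t g i l s').mul
      (hasDerivAt_kernelIntegrand_curve B t g i l s')).congr_deriv ?_
    ring

/-- The sum of squares of the fields, applied to the integrand. -/
theorem sum_logDer (B : HTypeAlgebra n m) {t : ℝ} (ht : 0 < t) (g : Grp n m) {l : Ver m}
    (hl : l ≠ 0) :
    ∑ i, (logDer B t g i l 0 * logDer B t g i l 0 - (1 / 2 * (‖l‖ * coth (t * ‖l‖)) : ℝ)) =
      ((1 / 4 * (‖l‖ / Real.sinh (t * ‖l‖)) ^ 2 * ‖g.1‖ ^ 2
        - n * (‖l‖ * coth (t * ‖l‖)) : ℝ) : ℂ) := by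
  set c := ‖l‖ * coth (t * ‖l‖) with hc
  set v := J B.bracket l g.1 with hv
  have hvi : ∀ i, ⟪v, EuclideanSpace.single i 1⟫ = v i := fun i => by
    simp [EuclideanSpace.inner_single_right]
  have hvn : ‖v‖ = ‖l‖ * ‖g.1‖ := by
    have h0 : ‖l‖ ≠ 0 := norm_ne_zero_iff.2 hl
    have h1 := B.orthogonal_J (‖l‖⁻¹ • l) (by rw [norm_smul, norm_inv, norm_norm]; field_simp) g.1
    have h2 : J B.bracket (‖l‖⁻¹ • l) g.1 = ‖l‖⁻¹ • v := by
      rw [hv]; unfold J; rw [map_smul]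
    rw [h2, norm_smul, norm_inv, norm_norm] at h1
    rw [← h1]; field_simp
  have hv2 : ∑ i, v i ^ 2 = ‖l‖ ^ 2 * ‖g.1‖ ^ 2 := by
    rw [← EuclideanSpace.real_norm_sq_eq, hvn]; ring
  have hx2 : ∑ i, g.1 i ^ 2 = ‖g.1‖ ^ 2 := (EuclideanSpace.real_norm_sq_eq _).symm
  have hvx : ∑ i, v i * g.1 i = 0 := by
    have : ⟪v, g.1⟫ = 0 := by rw [hv, inner_J, B.bracket_self, inner_zero_right]
    rw [PiLp.inner_apply] at this
    simpa [mul_comm] using this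
  have hcs : c ^ 2 - ‖l‖ ^ 2 = (‖l‖ / Real.sinh (t * ‖l‖)) ^ 2 := by
    have h0 : 0 < ‖l‖ := norm_pos_iff.2 hl
    have hs : Real.sinh (t * ‖l‖) ≠ 0 := (Real.sinh_pos_iff.2 (by positivity)).ne'
    rw [hc]; unfold coth
    field_simp
    rw [Real.cosh_sq]; ring
  have hterm : ∀ i, logDer B t g i l 0 * logDer B t g i l 0 - ((1 / 2 * c : ℝ) : ℂ) =
      ((-(1 / 4) * v i ^ 2 + 1 / 4 * c ^ 2 * g.1 i ^ 2 - 1 / 2 * c : ℝ) : ℂ)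
        + Complex.I * ((-(1 / 2) * c * (v i * g.1 i) : ℝ) : ℂ) := by
    intro i
    unfold logDer
    rw [← hv, hvi, ← hc]
    push_cast
    linear_combination (1 / 4 * (v i : ℂ) ^ 2) * Complex.I_sq
  simp only [hterm]
  rw [Finset.sum_add_distrib, ← Finset.mul_sum, ← Complex.ofReal_sum, ← Complex.ofReal_sum,
    ← Finset.mul_sum, hvx, mul_zero, Complex.ofReal_zero, mul_zero, add_zero]
  congr 1
  rw [Finset.sum_sub_distrib, Finset.sum_add_distrib, ← Finset.mul_sum, ← Finset.mul_sum, hv2, hx2,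
    ← hcs]
  simp
  ring

theorem hasDerivAt_kernelIntegrand_time {t : ℝ} (ht : 0 < t) (g : Grp n m)
    {l : Ver m} (hl : l ≠ 0) :
    HasDerivAt (fun t => kernelIntegrand t g l)
      (((1 / 4 * (‖l‖ / Real.sinh (t * ‖l‖)) ^ 2 * ‖g.1‖ ^ 2
        - n * (‖l‖ * coth (t * ‖l‖)) : ℝ) : ℂ) * kernelIntegrand t g l) t := by
  have h0 : 0 < ‖l‖ := norm_pos_iff.2 hl
  have hs : Real.sinh (t * ‖l‖) ≠ 0 := (Real.sinh_pos_iff.2 (by positivity)).ne'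
  have hlin : HasDerivAt (fun t : ℝ => t * ‖l‖) ‖l‖ t := by
    simpa using (hasDerivAt_id t).mul_const ‖l‖
  have hc : HasDerivAt (fun t : ℝ => 1 / 4 * (‖l‖ * coth (t * ‖l‖)) * ‖g.1‖ ^ 2)
      (-(1 / 4 * (‖l‖ / Real.sinh (t * ‖l‖)) ^ 2 * ‖g.1‖ ^ 2)) t := by
    have h := (((hlin.cosh.div hlin.sinh hs).const_mul ‖l‖).const_mul (1 / 4)).mul_const (‖g.1‖ ^ 2)
    refine h.congr_deriv ?_
    have := Real.cosh_sq (‖l‖ * t)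
    field_simp
    linear_combination (-‖g.1‖ ^ 2) * this
  have hw : HasDerivAt (fun t : ℝ => (‖l‖ / Real.sinh (t * ‖l‖)) ^ n)
      (-(n * (‖l‖ * coth (t * ‖l‖))) * (‖l‖ / Real.sinh (t * ‖l‖)) ^ n) t := by
    have h := (((hasDerivAt_const t ‖l‖).div hlin.sinh hs).pow n)
    refine h.congr_deriv ?_
    unfold coth
    rcases n with _ | k
    · simp
    · simp only [Nat.add_sub_cancel, pow_succ, Pi.div_apply]
      field_simp
      ring
  unfold kernelIntegrand
  refine ((hc.ofReal_comp.const_sub _).cexp.mul hw.ofReal_comp).congr_deriv ?_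
  push_cast
  ring

theorem hasDerivAt_integral_time (hn : 0 < n) (hm : 0 < m) {t : ℝ} (ht : 0 < t)
    (g : Grp n m) :
    HasDerivAt (fun t => ∫ l : Ver m, kernelIntegrand t g l)
      (∫ l : Ver m, ((1 / 4 * (‖l‖ / Real.sinh (t * ‖l‖)) ^ 2 * ‖g.1‖ ^ 2
        - n * (‖l‖ * coth (t * ‖l‖)) : ℝ) : ℂ) * kernelIntegrand t g l) t := by
  have ht2 : 0 < t / 2 := by positivity
  obtain ⟨b, hb, hbd⟩ := integrable_bound (n := n) (m := m) hn ht2 1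
  obtain ⟨C, hC, hw⟩ := sinh_weight_bound ht2 0
  have hne : Nonempty (Fin m) := ⟨⟨0, hm⟩⟩
  have hae : ∀ᵐ l : Ver m, l ≠ 0 := by
    rw [ae_iff]; simp
  set D : ℝ := 1 / 4 * C ^ 2 * ‖g.1‖ ^ 2 + n * (1 + 2 / t) with hD
  have hD0 : 0 ≤ D := by positivity
  have hmeas : Measurable (fun l : Ver m => (((1 / 4 * (‖l‖ / Real.sinh (t * ‖l‖)) ^ 2 * ‖g.1‖ ^ 2
        - n * (‖l‖ * coth (t * ‖l‖)) : ℝ)) : ℂ) * kernelIntegrand t g l) := by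
    refine Measurable.mul ?_ (measurable_kernelIntegrand t g)
    unfold coth; fun_prop
  refine (hasDerivAt_integral_of_dominated_loc_of_deriv_le (bound := fun l => D * b l)
    (F' := fun t l => ((1 / 4 * (‖l‖ / Real.sinh (t * ‖l‖)) ^ 2 * ‖g.1‖ ^ 2
        - n * (‖l‖ * coth (t * ‖l‖)) : ℝ) : ℂ) * kernelIntegrand t g l)
    (Ioi_mem_nhds (half_lt_self ht)) (.of_forall fun s =>
      (measurable_kernelIntegrand s _).aestronglyMeasurable)
    (integrable_kernelIntegrand hn ht _) hmeas.aestronglyMeasurable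
    (.of_forall fun l s hs => ?_) (hb.const_mul D)
    (hae.mono fun l hl s hs => hasDerivAt_kernelIntegrand_time (ht2.trans hs) g hl)).2
  have hs : t / 2 < s := hs
  have hs0 : 0 < s := ht2.trans hs
  have hl := norm_nonneg l
  have h1 := norm_kernelIntegrand_le hs0 g l
  have h2 := hbd s hs.le l
  rw [pow_one] at h2
  have h3 := hw s ‖l‖ hs.le hl
  rw [pow_zero, one_mul] at h3
  have h4 := sinh_weight_nonneg hs0 hl
  have h5 := coth_weight_bound hs0 hl
  have h6 : 1 / s ≤ 2 / t := by
    rw [div_le_div_iff₀ hs0 ht]; linarith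
  rw [norm_mul, Complex.norm_real]
  have h7 : ‖1 / 4 * (‖l‖ / Real.sinh (s * ‖l‖)) ^ 2 * ‖g.1‖ ^ 2
      - n * (‖l‖ * coth (s * ‖l‖))‖ ≤ D * (1 + ‖l‖) := by
    refine (norm_sub_le _ _).trans ?_
    have hn0 : (0 : ℝ) ≤ n := Nat.cast_nonneg n
    rw [Real.norm_of_nonneg (by positivity), Real.norm_of_nonneg (mul_nonneg hn0 h5.1)]
    have h8 : ‖l‖ * coth (s * ‖l‖) ≤ (1 + 2 / t) * (1 + ‖l‖) := by
      have : 0 ≤ 2 / t := by positivity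
      nlinarith [h5.2]
    have h9 : 1 / 4 * (‖l‖ / Real.sinh (s * ‖l‖)) ^ 2 * ‖g.1‖ ^ 2 ≤ 1 / 4 * C ^ 2 * ‖g.1‖ ^ 2 := by
      gcongr
    have h10 : (n : ℝ) * (‖l‖ * coth (s * ‖l‖)) ≤ n * ((1 + 2 / t) * (1 + ‖l‖)) := by gcongr
    have h11 : 0 ≤ 1 / 4 * C ^ 2 * ‖g.1‖ ^ 2 * ‖l‖ := by positivity
    rw [hD]
    nlinarith
  calc _ ≤ D * (1 + ‖l‖) * (‖l‖ / Real.sinh (s * ‖l‖)) ^ n := by gcongr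
    _ ≤ D * b l := by rw [mul_assoc]; gcongr

/-- The heat kernel solves the heat equation `∂ₜ p_t = L p_t`. -/
theorem hasDerivAt_heatKernel (B : HTypeAlgebra n m) (hn : 0 < n) (hm : 0 < m) {t : ℝ} (ht : 0 < t)
    (g : Grp n m) :
    HasDerivAt (fun s => heatKernel s g) (sublaplacian B (heatKernel t) g) t := by
  set K : ℝ := ((2 * Real.pi) ^ m)⁻¹ * ((4 * Real.pi) ^ n)⁻¹ with hK
  have hre : ∀ {f : ℝ → ℂ} {f' : ℂ} {x : ℝ}, HasDerivAt f f' x →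
      HasDerivAt (fun x => K * (f x).re) (K * f'.re) x := fun h =>
    (Complex.reCLM.hasFDerivAt.comp_hasDerivAt _ h).const_mul K
  have hzero : ∀ (g : Grp n m) i, mul B g (hvec m i 0) = g := by
    intro g i
    have h0 : (EuclideanSpace.single i (0 : ℝ) : Hor n) = 0 := by ext j; simp
    simp [mul, hvec, h0]
  have hX : ∀ (g : Grp n m) i s, s ∈ Ioo (-1 : ℝ) 1 → X B i (heatKernel t) (mul B g (hvec m i s)) =
      K * (∫ l, logDer B t g i l s * kernelIntegrand t (mul B g (hvec m i s)) l).re := by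
    intro g i s hs
    unfold X
    simp only [mul_hvec_hvec]
    have h := hre (hasDerivAt_integral_curve B hn ht g i hs)
    have h' : HasDerivAt (fun s' => heatKernel t (mul B g (hvec m i s')))
      (K * (∫ l, logDer B t g i l s * kernelIntegrand t (mul B g (hvec m i s)) l).re) (s + 0) := by
      rw [add_zero]; exact h
    exact (h'.comp_const_add s 0).deriv
  have hXX : ∀ i, X B i (X B i (heatKernel t)) g = K * (∫ l, (logDer B t g i l 0 *
      logDer B t g i l 0 - (1 / 2 * (‖l‖ * coth (t * ‖l‖)) : ℝ)) * kernelIntegrand t g l).re := by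
    intro i
    have h := hre (hasDerivAt_integral_curve' B hn ht g i).2
    rw [hzero] at h
    have hev : (fun s : ℝ => X B i (heatKernel t) (mul B g (hvec m i s))) =ᶠ[𝓝 0] fun s =>
        K * (∫ l, logDer B t g i l s * kernelIntegrand t (mul B g (hvec m i s)) l).re := by
      filter_upwards [Ioo_mem_nhds (a := (-1 : ℝ)) (b := 1) (by norm_num) (by norm_num)] with s hs
      exact hX g i s hs
    rw [X, hev.deriv_eq]
    exact h.deriv
  refine (hre (hasDerivAt_integral_time hn hm ht g)).congr_deriv ?_
  unfold sublaplacian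
  simp only [hXX]
  rw [← Finset.mul_sum, ← Complex.re_sum, ← integral_finsetSum]
  · congr 2
    have hne : Nonempty (Fin m) := ⟨⟨0, hm⟩⟩
    have hae : ∀ᵐ l : Ver m, l ≠ 0 := by
      rw [ae_iff]; simp
    refine integral_congr_ae (hae.mono fun l hl => ?_)
    simp only
    rw [← Finset.sum_mul, sum_logDer B ht g hl]
  · intro i _
    have h := (hasDerivAt_integral_curve' B hn ht g i).1
    rwa [hzero] at h

end HType

end

/-! Scaling makes the constant independent of time. The dilations `dil s` are group automorphisms
that multiply horizontal gradients by `s`, preserve the class `𝒞`, and carry `p_t dk` to `p_{s²t}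
dk`. Hence the ratio of `f` at time `s²t` and point `δ_s g` equals that of `f ∘ δ_s` at time `t` and
point `g`, and only `t = 1` matters.

The bound at `t = 1` comes from one function at the identity. There the left-invariant derivative of
`P_1 f` is the integral of the right-invariant derivative of `f` (`X_heat_one_zero`). For `f = a x_i
+ ⟨u,z⟩⟨x,v⟩` with `v = J_u e_i`, the bracket makes the two derivatives differ: `X_i f = a -
½⟨x,v⟩²` and `X̂_i f = a + ½⟨x,v⟩²`. Since `⟨x,v⟩²` has mean `2` under `p_1`, the numerator is at
least `a + 1`. By Jensen's inequality the square of the denominator is at most the mean of `|∇f|²`,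
which is at most `a² - 2a + 3n + 2`. The choice `a = (3n+3)/2` maximises the quotient and gives
`√((3n+5)/(3n+1)) > 1`. The function `f` is replaced by truncations of compact support, which lie in
`𝒞`, and a limit is taken (`le_Kopt_one`).

The analytic work is to show that `p_1` is a probability density with the required moments.
Positivity follows from the Euler products: `r / sinh r` and `exp (-b r coth r)`, with `b ≥ 0`, are
limits of products of factors that are mixtures of Gaussians in `λ` or power series with nonnegative
coefficients in such mixtures (`gaussPos_profile`). Positivity yields integrability in `z`, and
Fourier inversion then shows that the `x`-marginal is Gaussian and that the characteristic function
in `z` is `(cosh |μ|)⁻ⁿ`. All moments are read off from these two facts.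

At `t = 0` every ratio is `1`, so a value above `1` for all `t > 0` forces the discontinuity. -/

noncomputable section

namespace HType

variable {n m : ℕ}

/-! ### Dilations and independence of time. -/

/-- The dilation `δ_s (x, z) = (s x, s² z)`. -/
def dil (s : ℝ) (g : Grp n m) : Grp n m := (s • g.1, s ^ 2 • g.2)

theorem dil_dil_inv {s : ℝ} (hs : s ≠ 0) (g : Grp n m) : dil s (dil s⁻¹ g) = g := by
  simp [dil, smul_smul, hs]

theorem dil_mul (B : HTypeAlgebra n m) (s : ℝ) (g h : Grp n m) :
    dil s (mul B g h) = mul B (dil s g) (dil s h) := by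
  refine Prod.ext ?_ ?_
  · simp [dil, mul]
  · simp only [dil, mul, map_smul, LinearMap.smul_apply, smul_add, smul_smul]
    congr 2
    ring

theorem dil_hvec (s u : ℝ) (i : Fin (2 * n)) : dil s (hvec m i u) = hvec m i (s * u) := by
  refine Prod.ext ?_ ?_
  · ext j; simp [dil, hvec, mul_ite]
  · simp [dil, hvec]

theorem grad_comp_dil (B : HTypeAlgebra n m) (f : Grp n m → ℝ) (s : ℝ) (g : Grp n m) :
    grad B (fun k => f (dil s k)) g = s • grad B f (dil s g) := by
  ext i
  simp only [grad, X, dil_mul, dil_hvec, PiLp.smul_apply, smul_eq_mul]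
  have := deriv_comp_mul_left s (fun u : ℝ => f (mul B (dil s g) (hvec m i u))) 0
  simpa using this

theorem gradHat_comp_dil (B : HTypeAlgebra n m) (f : Grp n m → ℝ) (s : ℝ) (g : Grp n m) :
    gradHat B (fun k => f (dil s k)) g = s • gradHat B f (dil s g) := by
  ext i
  simp only [gradHat, XHat, dil_mul, dil_hvec, PiLp.smul_apply, smul_eq_mul]
  have := deriv_comp_mul_left s (fun u : ℝ => f (mul B (hvec m i u) (dil s g))) 0
  simpa using this

theorem contDiff_dil (s : ℝ) : ContDiff ℝ 1 (dil s : Grp n m → Grp n m) := by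
  unfold dil; fun_prop

/-- The dilation as a continuous linear map. -/
def dilCLM (s : ℝ) : Grp n m →L[ℝ] Grp n m :=
  (s • ContinuousLinearMap.fst ℝ (Hor n) (Ver m)).prod
    (s ^ 2 • ContinuousLinearMap.snd ℝ (Hor n) (Ver m))

theorem dilCLM_apply (s : ℝ) (g : Grp n m) : dilCLM s g = dil s g := rfl

theorem IsHorizontal.dil {B : HTypeAlgebra n m} {γ : ℝ → Grp n m} {a : ℝ → Hor n}
    (h : IsHorizontal B γ a) (s : ℝ) :
    IsHorizontal B (fun u => dil s (γ u)) (fun u => s • a u) := by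
  refine ⟨?_, h.2.1.const_smul s, h.2.2.mono fun u hu hmem => ?_⟩
  · rw [absolutelyContinuousOnInterval_iff]
    intro ε hε
    set C : ℝ := ‖(dilCLM s : Grp n m →L[ℝ] Grp n m)‖ + 1 with hC
    have hC0 : 0 < C := by positivity
    obtain ⟨δ, hδ, hb⟩ := (absolutelyContinuousOnInterval_iff _ _ _).1 h.1 (ε / C) (by positivity)
    refine ⟨δ, hδ, fun E hE hlt => ?_⟩
    have h1 := hb E hE hlt
    rw [lt_div_iff₀ hC0, Finset.sum_mul] at h1
    refine lt_of_le_of_lt (Finset.sum_le_sum fun i _ => ?_) h1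
    have h2 := (dilCLM s : Grp n m →L[ℝ] Grp n m).dist_le_opNorm (γ (E.2 i).1) (γ (E.2 i).2)
    have h3 := dist_nonneg (x := γ (E.2 i).1) (y := γ (E.2 i).2)
    rw [dilCLM_apply, dilCLM_apply] at h2
    nlinarith
  · refine (((dilCLM s).hasFDerivAt.comp_hasDerivAt u (hu hmem))).congr_deriv ?_
    rw [map_sum]
    refine Finset.sum_congr rfl fun i _ => ?_
    rw [map_smul, dilCLM_apply]
    refine Prod.ext ?_ ?_
    · simp [HType.dil, XVec, smul_smul, mul_comm]
    · simp only [HType.dil, XVec, PiLp.smul_apply, Prod.smul_snd, map_smul, LinearMap.smul_apply,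
        smul_smul]
      congr 1
      simp only [smul_eq_mul]
      ring

/-- Dilating a horizontal path multiplies its coefficients, hence its length, by `s`. Applying this
to `s` and to `s⁻¹` identifies the two sets of lengths. -/
theorem ccDist_dil (B : HTypeAlgebra n m) {s : ℝ} (hs : 0 < s) (g h : Grp n m) :
    ccDist B (dil s g) (dil s h) = s * ccDist B g h := by
  have key : ∀ {s : ℝ}, 0 < s → ∀ {g h : Grp n m} {l : ℝ},
      (∃ (γ : ℝ → Grp n m) (a : ℝ → Hor n), IsHorizontal B γ a ∧ γ 0 = g ∧ γ 1 = h ∧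
        l = ∫ s in (0 : ℝ)..1, ‖a s‖) →
      ∃ (γ : ℝ → Grp n m) (a : ℝ → Hor n), IsHorizontal B γ a ∧ γ 0 = dil s g ∧ γ 1 = dil s h ∧
        s * l = ∫ s in (0 : ℝ)..1, ‖a s‖ := by
    rintro s hs g h l ⟨γ, a, hγ, rfl, rfl, rfl⟩
    refine ⟨_, _, hγ.dil s, rfl, rfl, ?_⟩
    simp only [norm_smul, intervalIntegral.integral_const_mul, Real.norm_of_nonneg hs.le]
  have hinv : ∀ k : Grp n m, dil s⁻¹ (dil s k) = k := fun k => by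
    simp [dil, smul_smul, hs.ne']
  unfold ccDist
  refine Eq.trans ?_ (Real.sInf_smul_of_nonneg hs.le _)
  congr 1
  ext l
  rw [Set.mem_smul_set]
  constructor
  · intro hl
    have := key (inv_pos.2 hs) hl
    simp only [hinv] at this
    exact ⟨s⁻¹ * l, this, by simp [hs.ne']⟩
  · rintro ⟨l, hl, rfl⟩
    exact key hs hl

theorem ClassC.comp_dil {B : HTypeAlgebra n m} {f : Grp n m → ℝ} (hf : f ∈ ClassC B) {s : ℝ}
    (hs : 0 < s) : (fun k => f (dil s k)) ∈ ClassC B := by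
  obtain ⟨hc, M, a, ε, hM, ha, hε, hε1, hb⟩ := hf
  -- The factor `1 + s` covers both the value of `f`, which is unscaled, and the gradients, which
  -- gain a factor `s`; the exponent absorbs `d(0, δ_s g) = s d(0, g)`.
  refine ⟨hc.comp (contDiff_dil s), (1 + s) * M, a * s ^ (2 - ε), ε, by positivity, by positivity,
    hε, hε1, fun g => ?_⟩
  have h0 : (0 : Grp n m) = dil s 0 := by simp [dil]; rfl
  have hd : 0 ≤ ccDist B 0 g := by
    refine Real.sInf_nonneg ?_
    rintro _ ⟨γ, b, -, -, -, rfl⟩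
    exact intervalIntegral.integral_nonneg zero_le_one fun _ _ => norm_nonneg _
  have h1 := hb (dil s g)
  rw [h0, ccDist_dil B hs, Real.mul_rpow hs.le hd, ← mul_assoc] at h1
  rw [grad_comp_dil, gradHat_comp_dil, norm_smul, norm_smul, Real.norm_of_nonneg hs.le, mul_assoc (1 + s)]
  refine le_trans ?_ (mul_le_mul_of_nonneg_left h1 (by positivity))
  have := abs_nonneg (f (dil s g))
  have := norm_nonneg (grad B f (dil s g))
  have := norm_nonneg (gradHat B f (dil s g))
  nlinarith

/-- Substitute `λ ↦ s⁻² λ` in the defining integral: the weight `(|λ| / sinh)ⁿ` contributes `s⁻²ⁿ`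
and `dλ` contributes `s⁻²ᵐ`. The same exponent `2n + 2m` is the Jacobian exponent of `dil s`, so the
measure `p_t dk` is transported without loss. -/
theorem heatKernel_dil {s : ℝ} (hs : 0 < s) (t : ℝ) (g : Grp n m) :
    heatKernel (s ^ 2 * t) (dil s g) = (s ^ (2 * n + 2 * m))⁻¹ * heatKernel t g := by
  have hint : ∀ l : Ver m, kernelIntegrand (s ^ 2 * t) (dil s g) ((s ^ 2)⁻¹ • l) =
      ((s ^ (2 * n))⁻¹ : ℝ) • kernelIntegrand t g l := by
    intro l
    have hs2 : (0 : ℝ) < s ^ 2 := by positivity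
    have e1 : s ^ 2 * t * ‖(s ^ 2)⁻¹ • l‖ = t * ‖l‖ := by
      rw [norm_smul, norm_inv, Real.norm_of_nonneg hs2.le]; field_simp
    have e2 : ⟪(s ^ 2)⁻¹ • l, (dil s g).2⟫ = ⟪l, g.2⟫ := by
      simp only [dil, inner_smul_left, inner_smul_right]
      simp; field_simp
    have e3 : 1 / 4 * (‖(s ^ 2)⁻¹ • l‖ * coth (t * ‖l‖)) * ‖(dil s g).1‖ ^ 2 =
        1 / 4 * (‖l‖ * coth (t * ‖l‖)) * ‖g.1‖ ^ 2 := by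
      simp only [dil, norm_smul, norm_inv, Real.norm_of_nonneg hs2.le, Real.norm_of_nonneg hs.le]
      field_simp
    have e4 : (‖(s ^ 2)⁻¹ • l‖ / Real.sinh (t * ‖l‖)) ^ n =
        (s ^ (2 * n))⁻¹ * (‖l‖ / Real.sinh (t * ‖l‖)) ^ n := by
      rw [norm_smul, norm_inv, Real.norm_of_nonneg hs2.le, mul_div_assoc, mul_pow, inv_pow, ← pow_mul]
    unfold kernelIntegrand
    rw [e1, e2, e3, e4, Complex.real_smul]
    push_cast
    ring
  have h := Measure.integral_comp_smul (μ := (volume : Measure (Ver m)))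
    (fun l => kernelIntegrand (s ^ 2 * t) (dil s g) l) (s ^ 2)⁻¹
  simp only [hint, integral_smul, finrank_euclideanSpace_fin] at h
  have h2 : (∫ l : Ver m, kernelIntegrand (s ^ 2 * t) (dil s g) l) =
      ((s ^ (2 * n + 2 * m))⁻¹ : ℝ) • ∫ l : Ver m, kernelIntegrand t g l := by
    rw [inv_pow, inv_inv, abs_of_nonneg (by positivity)] at h
    rw [pow_add, mul_inv, mul_comm _ (s ^ (2 * m))⁻¹, mul_smul, h, smul_smul, ← pow_mul, inv_mul_cancel₀, one_smul]
    positivity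
  unfold heatKernel
  rw [h2, Complex.smul_re, smul_eq_mul]
  ring

theorem integral_comp_dil {s : ℝ} (hs : 0 < s) (f : Grp n m → ℝ) :
    ∫ k, f (dil s k) = (s ^ (2 * n + 2 * m))⁻¹ * ∫ k, f k := by
  have hs2 : (0 : ℝ) < s ^ 2 := by positivity
  have hmap : Measure.map (dil s) (volume : Measure (Grp n m)) =
      ENNReal.ofReal (s ^ (2 * n + 2 * m))⁻¹ • volume := by
    have h1 := Measure.map_addHaar_smul (volume : Measure (Hor n)) hs.ne'
    have h2 := Measure.map_addHaar_smul (volume : Measure (Ver m)) hs2.ne'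
    have : (dil s : Grp n m → Grp n m) = Prod.map (s • ·) (s ^ 2 • ·) := rfl
    rw [this, Measure.volume_eq_prod, ← Measure.map_prod_map _ _ (by fun_prop) (by fun_prop), h1, h2,
      Measure.prod_smul_left, Measure.prod_smul_right, smul_smul, ← ENNReal.ofReal_mul (by positivity)]
    congr 2
    rw [abs_of_nonneg (by positivity), abs_of_nonneg (by positivity), finrank_euclideanSpace_fin,
      finrank_euclideanSpace_fin, pow_add, ← pow_mul, mul_inv]
  let e : Grp n m ≃ₜ Grp n m :=
    { toFun := dil s, invFun := dil s⁻¹, left_inv := fun k => by simp [dil, smul_smul, hs.ne'],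
      right_inv := dil_dil_inv hs.ne', continuous_toFun := (contDiff_dil s).continuous,
      continuous_invFun := (contDiff_dil s⁻¹).continuous }
  have h := e.measurableEmbedding.integral_map (μ := volume) f
  have he : (e : Grp n m → Grp n m) = dil s := rfl
  rw [he, hmap, integral_smul_measure, ENNReal.toReal_ofReal (by positivity), smul_eq_mul] at h
  exact h.symm

theorem heat_dil (B : HTypeAlgebra n m) {s : ℝ} (hs : 0 < s) {t : ℝ} (ht : t ≠ 0)
    (f : Grp n m → ℝ) (g : Grp n m) :
    heat B (s ^ 2 * t) f (dil s g) = heat B t (fun k => f (dil s k)) g := by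
  have hst : s ^ 2 * t ≠ 0 := by positivity
  unfold heat
  rw [if_neg ht, if_neg hst]
  have h := integral_comp_dil hs fun k => f (mul B (dil s g) k) * heatKernel (s ^ 2 * t) k
  simp only [heatKernel_dil hs, dil_mul] at h ⊢
  have hp : (s ^ (2 * n + 2 * m))⁻¹ ≠ 0 := by positivity
  apply mul_left_cancel₀ hp
  rw [← h, ← integral_const_mul]
  congr 1; ext k; ring

/-- A competitor `(f, δ_s g)` at time `s² t` yields the competitor `(f ∘ δ_s, g)` at time `t` with
the same ratio, since numerator and denominator both gain the factor `s`. -/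
theorem Kopt_le_Kopt_scale (B : HTypeAlgebra n m) {s : ℝ} (hs : 0 < s) {t : ℝ} (ht : t ≠ 0) :
    Kopt B (s ^ 2 * t) ≤ Kopt B t := by
  refine sSup_le_sSup ?_
  rintro _ ⟨f, hf, g', hne, rfl⟩
  obtain ⟨g, rfl⟩ : ∃ g, g' = dil s g := ⟨dil s⁻¹ g', (dil_dil_inv hs.ne' g').symm⟩
  have h1 : heat B t (fun k => ‖grad B (fun k => f (dil s k)) k‖) g =
      s * heat B (s ^ 2 * t) (fun k => ‖grad B f k‖) (dil s g) := by
    rw [heat_dil B hs ht]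
    simp only [grad_comp_dil, norm_smul, Real.norm_of_nonneg hs.le]
    unfold heat
    rw [if_neg ht, if_neg ht, ← integral_const_mul]
    congr 1; ext k; ring
  have h2 : grad B (heat B t (fun k => f (dil s k))) g =
      s • grad B (heat B (s ^ 2 * t) f) (dil s g) := by
    rw [← grad_comp_dil]
    congr 1
    ext k
    rw [heat_dil B hs ht]
  refine ⟨_, ClassC.comp_dil hf hs, g, ?_, ?_⟩
  · rw [h1]; exact mul_ne_zero hs.ne' hne
  · rw [h1, h2, norm_smul, Real.norm_of_nonneg hs.le, mul_div_mul_left _ _ hs.ne']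

theorem Kopt_eq_Kopt_one (B : HTypeAlgebra n m) {t : ℝ} (ht : 0 < t) : Kopt B t = Kopt B 1 := by
  have hs := Real.sqrt_pos.2 ht
  have hsq := Real.sq_sqrt ht.le
  apply le_antisymm
  · have := Kopt_le_Kopt_scale B hs one_ne_zero
    rwa [hsq, mul_one] at this
  · have := Kopt_le_Kopt_scale B (inv_pos.2 hs) ht.ne'
    rwa [inv_pow, hsq, inv_mul_cancel₀ ht.ne'] at this

/-! ### Positivity of the heat kernel through mixtures of Gaussians. -/

theorem integrable_gaussian {ι : Type*} [Fintype ι] {b : ℝ} (hb : 0 < b) :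
    Integrable (fun v : EuclideanSpace ℝ ι => Real.exp (-b * ‖v‖ ^ 2)) := by
  have h := GaussianFourier.integrable_cexp_neg_mul_sq_norm_add (V := EuclideanSpace ℝ ι)
    (b := (b : ℂ)) (by simpa using hb) 0 0
  refine h.norm.congr (.of_forall fun v => ?_)
  simp only [Complex.norm_exp]
  norm_cast
  simp

theorem integral_cos_mul_gaussian {b : ℝ} (hb : 0 < b) (z : Ver m) :
    ∫ l : Ver m, Real.cos ⟪l, z⟫ * Real.exp (-b * ‖l‖ ^ 2) =
      (Real.pi / b) ^ (m / 2 : ℝ) * Real.exp (-‖z‖ ^ 2 / (4 * b)) := by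
  have hb' : 0 < (b : ℂ).re := by simpa using hb
  have h := GaussianFourier.integral_cexp_neg_mul_sq_norm_add (V := Ver m) hb' Complex.I z
  have hint := GaussianFourier.integrable_cexp_neg_mul_sq_norm_add (V := Ver m) hb' Complex.I z
  have h1 := congrArg Complex.re h
  rw [← Complex.reCLM_apply, ← ContinuousLinearMap.integral_comp_comm _ hint] at h1
  have e1 : ∀ l : Ver m, Complex.reCLM (Complex.exp (-(b : ℂ) * ‖l‖ ^ 2 + Complex.I * ⟪z, l⟫)) =
      Real.cos ⟪l, z⟫ * Real.exp (-b * ‖l‖ ^ 2) := by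
    intro l
    have : -(b : ℂ) * ‖l‖ ^ 2 + Complex.I * ⟪z, l⟫ =
        ((-b * ‖l‖ ^ 2 : ℝ) : ℂ) + (⟪l, z⟫ : ℝ) * Complex.I := by
      rw [real_inner_comm]; push_cast; ring
    rw [Complex.reCLM_apply, this, Complex.exp_add, ← Complex.ofReal_exp, Complex.re_ofReal_mul,
      Complex.exp_ofReal_mul_I_re, mul_comm]
  simp only [e1] at h1
  rw [h1, finrank_euclideanSpace_fin]
  have e2 : ((Real.pi : ℂ) / b) ^ ((m : ℂ) / 2) * Complex.exp (Complex.I ^ 2 * ‖z‖ ^ 2 / (4 * b)) =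
      (((Real.pi / b) ^ (m / 2 : ℝ) * Real.exp (-‖z‖ ^ 2 / (4 * b)) : ℝ) : ℂ) := by
    rw [Complex.I_sq]
    push_cast
    rw [Complex.ofReal_cpow (by positivity)]
    push_cast
    rw [neg_one_mul]
  rw [e2, Complex.ofReal_re]

/-- Bounded functions on `ℝᵐ` whose products with Gaussians have nonnegative Fourier transforms. -/
structure GaussPos (φ : Ver m → ℝ) : Prop where
  measurable : Measurable φ
  bounded : ∃ C, ∀ l, |φ l| ≤ C
  nonneg : ∀ δ > 0, ∀ z, 0 ≤ ∫ l, Real.cos ⟪l, z⟫ * φ l * Real.exp (-δ * ‖l‖ ^ 2)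

namespace GaussPos

variable {φ ψ : Ver m → ℝ}

theorem integrable (hφ : GaussPos φ) {δ : ℝ} (hδ : 0 < δ) (z : Ver m) :
    Integrable fun l => Real.cos ⟪l, z⟫ * φ l * Real.exp (-δ * ‖l‖ ^ 2) := by
  obtain ⟨C, hC⟩ := hφ.bounded
  have := hφ.measurable
  refine ((integrable_gaussian hδ).const_mul C).mono'
    (Measurable.aestronglyMeasurable (by fun_prop)) (.of_forall fun l => ?_)
  rw [norm_mul, norm_mul, Real.norm_of_nonneg (Real.exp_pos _).le]
  gcongr
  calc _ ≤ 1 * C := by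
        gcongr
        · exact Real.abs_cos_le_one _
        · exact hC l
    _ = C := one_mul C

theorem const {c : ℝ} (hc : 0 ≤ c) : GaussPos (fun _ : Ver m => c) := by
  refine ⟨measurable_const, ⟨|c|, fun _ => le_rfl⟩, fun δ hδ z => ?_⟩
  have : ∀ l : Ver m, Real.cos ⟪l, z⟫ * c * Real.exp (-δ * ‖l‖ ^ 2) =
      c * (Real.cos ⟪l, z⟫ * Real.exp (-δ * ‖l‖ ^ 2)) := fun l => by ring
  simp only [this]
  rw [integral_const_mul, integral_cos_mul_gaussian hδ]
  positivity

theorem add (hφ : GaussPos φ) (hψ : GaussPos ψ) : GaussPos (fun l => φ l + ψ l) := by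
  obtain ⟨C, hC⟩ := hφ.bounded
  obtain ⟨D, hD⟩ := hψ.bounded
  refine ⟨hφ.measurable.add hψ.measurable,
    ⟨C + D, fun l => (abs_add_le _ _).trans (add_le_add (hC l) (hD l))⟩, fun δ hδ z => ?_⟩
  simp only [mul_add, add_mul]
  rw [integral_add (hφ.integrable hδ z) (hψ.integrable hδ z)]
  exact add_nonneg (hφ.nonneg δ hδ z) (hψ.nonneg δ hδ z)

theorem const_mul (hφ : GaussPos φ) {c : ℝ} (hc : 0 ≤ c) : GaussPos (fun l => c * φ l) := by
  obtain ⟨C, hC⟩ := hφ.bounded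
  refine ⟨hφ.measurable.const_mul c, ⟨c * C, fun l => ?_⟩, fun δ hδ z => ?_⟩
  · rw [abs_mul, abs_of_nonneg hc]
    exact mul_le_mul_of_nonneg_left (hC l) hc
  · have : ∀ l : Ver m, Real.cos ⟪l, z⟫ * (c * φ l) * Real.exp (-δ * ‖l‖ ^ 2) =
        c * (Real.cos ⟪l, z⟫ * φ l * Real.exp (-δ * ‖l‖ ^ 2)) := fun l => by ring
    simp only [this]
    rw [integral_const_mul]
    exact mul_nonneg hc (hφ.nonneg δ hδ z)

theorem sum {ι : Type*} (s : Finset ι) {F : ι → Ver m → ℝ} (h : ∀ i ∈ s, GaussPos (F i)) :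
    GaussPos (fun l => ∑ i ∈ s, F i l) := by
  classical
  induction s using Finset.induction_on with
  | empty => simpa using const (m := m) le_rfl
  | insert a s ha ih =>
    simp only [Finset.sum_insert ha]
    exact (h a (Finset.mem_insert_self _ _)).add
      (ih fun i hi => h i (Finset.mem_insert_of_mem hi))

/-- Dominated convergence applies with no integrability of the `F k` or of the limit, because the
definition of `GaussPos` carries a Gaussian factor. This closure property is the reason for testing
against every damping `δ > 0`. -/
theorem of_tendsto {F : ℕ → Ver m → ℝ} (hF : ∀ k, GaussPos (F k)) {C : ℝ}
    (hC : ∀ k l, |F k l| ≤ C) (h : ∀ l, Tendsto (fun k => F k l) atTop (𝓝 (φ l))) :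
    GaussPos φ := by
  refine ⟨measurable_of_tendsto_metrizable (fun k => (hF k).measurable) (tendsto_pi_nhds.2 h),
    ⟨C, fun l => le_of_tendsto (h l).abs (.of_forall fun k => hC k l)⟩, fun δ hδ z => ?_⟩
  refine ge_of_tendsto' (tendsto_integral_of_dominated_convergence
    (fun l => C * Real.exp (-δ * ‖l‖ ^ 2)) (F := fun k l => Real.cos ⟪l, z⟫ * F k l * Real.exp (-δ * ‖l‖ ^ 2))
    (fun k => ((hF k).integrable hδ z).aestronglyMeasurable)
    ((integrable_gaussian hδ).const_mul C) (fun k => .of_forall fun l => ?_)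
    (.of_forall fun l => ((h l).const_mul _).mul_const _)) fun k => (hF k).nonneg δ hδ z
  rw [norm_mul, norm_mul, Real.norm_of_nonneg (Real.exp_pos _).le]
  gcongr
  calc _ ≤ 1 * C := by
        gcongr
        · exact Real.abs_cos_le_one _
        · exact hC k l
    _ = C := one_mul C

/-- `c / (c + |l|²)` is a mixture of Gaussians. -/
theorem mul_resolvent (hφ : GaussPos φ) {c : ℝ} (hc : 0 < c) :
    GaussPos (fun l => c / (c + ‖l‖ ^ 2) * φ l) := by
  obtain ⟨C, hC⟩ := hφ.bounded
  have hm := hφ.measurable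
  have hle : ∀ l : Ver m, c / (c + ‖l‖ ^ 2) ≤ 1 := fun l => by
    rw [div_le_one (by positivity)]; nlinarith [sq_nonneg ‖l‖]
  refine ⟨by fun_prop, ⟨C, fun l => ?_⟩, fun δ hδ z => ?_⟩
  · rw [abs_mul, abs_of_nonneg (by positivity)]
    exact (mul_le_of_le_one_left (abs_nonneg _) (hle l)).trans (hC l)
  -- The Laplace representation of the resolvent; the Gaussian `exp (-s |l|²)` in it only raises the
  -- damping from `δ` to `δ + s`, where positivity is already known.
  have hmix : ∀ l : Ver m, ∫ s in Ioi (0 : ℝ), c * Real.exp (-(c + ‖l‖ ^ 2) * s) =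
      c / (c + ‖l‖ ^ 2) := fun l => by
    have hp : 0 < c + ‖l‖ ^ 2 := by positivity
    rw [integral_const_mul, integral_exp_mul_Ioi (by linarith)]
    rw [mul_zero, Real.exp_zero]
    field_simp
  have e1 : ∀ l : Ver m, Real.cos ⟪l, z⟫ * (c / (c + ‖l‖ ^ 2) * φ l) * Real.exp (-δ * ‖l‖ ^ 2) =
      ∫ s in Ioi (0 : ℝ), (c * Real.exp (-(c + ‖l‖ ^ 2) * s)) *
        (Real.cos ⟪l, z⟫ * φ l * Real.exp (-δ * ‖l‖ ^ 2)) := fun l => by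
    rw [integral_mul_const, hmix]; ring
  simp only [e1]
  rw [integral_integral_swap]
  · refine setIntegral_nonneg measurableSet_Ioi fun s hs => ?_
    have hs : 0 < s := hs
    have e2 : ∀ l : Ver m, (c * Real.exp (-(c + ‖l‖ ^ 2) * s)) *
        (Real.cos ⟪l, z⟫ * φ l * Real.exp (-δ * ‖l‖ ^ 2)) =
        (c * Real.exp (-c * s)) * (Real.cos ⟪l, z⟫ * φ l * Real.exp (-(δ + s) * ‖l‖ ^ 2)) := by
      intro l
      have : Real.exp (-(c + ‖l‖ ^ 2) * s) * Real.exp (-δ * ‖l‖ ^ 2) =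
          Real.exp (-c * s) * Real.exp (-(δ + s) * ‖l‖ ^ 2) := by
        rw [← Real.exp_add, ← Real.exp_add]; ring_nf
      linear_combination c * Real.cos ⟪l, z⟫ * φ l * this
    simp only [e2]
    rw [integral_const_mul]
    have := hφ.nonneg (δ + s) (by positivity) z
    positivity
  · have hexp : Integrable (fun s : ℝ => c * Real.exp (-c * s)) (volume.restrict (Ioi 0)) :=
      (exp_neg_integrableOn_Ioi 0 hc).const_mul c
    have hI := ((hφ.integrable hδ z).norm).mul_prod hexp
    refine hI.mono' (Measurable.aestronglyMeasurable ?_) ?_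
    · unfold Function.uncurry; fun_prop
    · have hae : ∀ᵐ p ∂((volume : Measure (Ver m)).prod (volume.restrict (Ioi (0 : ℝ)))), 0 < p.2 := by
        have := (Measure.quasiMeasurePreserving_snd (μ := (volume : Measure (Ver m)))
          (ν := volume.restrict (Ioi (0 : ℝ)))).ae (ae_restrict_mem measurableSet_Ioi)
        exact this
      filter_upwards [hae] with p hp
      simp only [Function.uncurry, norm_mul, Real.norm_of_nonneg hc.le, Real.norm_of_nonneg (Real.exp_pos _).le]
      rw [mul_comm]
      gcongr
      nlinarith [sq_nonneg ‖p.1‖]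

theorem mul_resolvent_pow (hφ : GaussPos φ) {c : ℝ} (hc : 0 < c) (k : ℕ) :
    GaussPos (fun l => (c / (c + ‖l‖ ^ 2)) ^ k * φ l) := by
  induction k with
  | zero => simpa using hφ
  | succ k ih =>
    simpa only [pow_succ', mul_assoc] using ih.mul_resolvent hc

/-- Because `|l|² / (c + |l|²) = 1 - c / (c + |l|²)`, the factor is `e⁻ᵃ` times an exponential
series with nonnegative coefficients in the resolvent. Its partial products with `φ` stay below the
bound of `φ`. -/
theorem mul_exp_resolvent (hφ : GaussPos φ) {c : ℝ} (hc : 0 < c) {a : ℝ} (ha : 0 ≤ a) :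
    GaussPos (fun l => Real.exp (-a * (‖l‖ ^ 2 / (c + ‖l‖ ^ 2))) * φ l) := by
  obtain ⟨C, hC⟩ := hφ.bounded
  have hψ0 : ∀ l : Ver m, 0 ≤ c / (c + ‖l‖ ^ 2) := fun l => by positivity
  have hψ1 : ∀ l : Ver m, c / (c + ‖l‖ ^ 2) ≤ 1 := fun l => by
    rw [div_le_one (by positivity)]; nlinarith [sq_nonneg ‖l‖]
  have hrw : ∀ l : Ver m, Real.exp (-a * (‖l‖ ^ 2 / (c + ‖l‖ ^ 2))) =
      Real.exp (-a) * Real.exp (a * (c / (c + ‖l‖ ^ 2))) := fun l => by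
    have : c + ‖l‖ ^ 2 ≠ 0 := by positivity
    rw [← Real.exp_add]
    congr 1
    field_simp
    ring
  have hterm : ∀ N l, ∑ j ∈ Finset.range N, Real.exp (-a) * (a ^ j / j.factorial) *
      ((c / (c + ‖l‖ ^ 2)) ^ j * φ l) = Real.exp (-a) *
      (∑ j ∈ Finset.range N, (a * (c / (c + ‖l‖ ^ 2))) ^ j / j.factorial) * φ l := by
    intro N l
    rw [Finset.mul_sum, Finset.sum_mul]
    refine Finset.sum_congr rfl fun j _ => ?_
    rw [mul_pow]; ring
  refine of_tendsto (C := C)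
    (F := fun N l => ∑ j ∈ Finset.range N, Real.exp (-a) * (a ^ j / j.factorial) *
      ((c / (c + ‖l‖ ^ 2)) ^ j * φ l))
    (fun N => sum _ fun j _ => (hφ.mul_resolvent_pow hc j).const_mul (by positivity))
    (fun N l => ?_) (fun l => ?_)
  · have hy : 0 ≤ a * (c / (c + ‖l‖ ^ 2)) := mul_nonneg ha (hψ0 l)
    rw [hterm, abs_mul, abs_of_nonneg (mul_nonneg (Real.exp_pos _).le
      (Finset.sum_nonneg fun j _ => by positivity))]
    refine (mul_le_of_le_one_left (abs_nonneg _) ?_).trans (hC l)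
    calc _ ≤ Real.exp (-a) * Real.exp (a * (c / (c + ‖l‖ ^ 2))) := by
          gcongr
          exact Real.sum_le_exp_of_nonneg hy N
      _ = Real.exp (-a * (‖l‖ ^ 2 / (c + ‖l‖ ^ 2))) := (hrw l).symm
      _ ≤ 1 := by
          rw [Real.exp_le_one_iff, neg_mul]
          exact neg_nonpos.2 (by positivity)
  · simp only [hterm, hrw]
    refine Tendsto.mul_const _ (Tendsto.const_mul _ ?_)
    have := (NormedSpace.expSeries_div_hasSum_exp (a * (c / (c + ‖l‖ ^ 2)))).tendsto_sum_nat
    rwa [← Real.exp_eq_exp_ℝ] at this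

end GaussPos

/-- The continuous extension of `r / sinh r`. -/
def wSinh (r : ℝ) : ℝ := if r = 0 then 1 else r / Real.sinh r

/-- The continuous extension of `r coth r`. -/
def rCoth (r : ℝ) : ℝ := Real.cosh r * wSinh r

/-- Euler's product for `sin (π z)` at `z = i r / π`, where it becomes `i sinh r`, then inverted. -/
theorem tendsto_prod_wSinh (r : ℝ) :
    Tendsto (fun N => ∏ j ∈ Finset.range N,
      (Real.pi * (j + 1)) ^ 2 / ((Real.pi * (j + 1)) ^ 2 + r ^ 2)) atTop (𝓝 (wSinh r)) := by
  have hpi := Real.pi_pos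
  unfold wSinh
  split_ifs with hr
  · refine tendsto_const_nhds.congr fun N => (Finset.prod_eq_one fun j _ => ?_).symm
    have : (0 : ℝ) < Real.pi * (j + 1) := by positivity
    rw [hr]; field_simp; simp
  have hs : Real.sinh r ≠ 0 := by rwa [Ne, Real.sinh_eq_zero]
  have h := Complex.tendsto_euler_sin_prod (Complex.I * r / Real.pi)
  have hpc : (Real.pi : ℂ) ≠ 0 := by exact_mod_cast hpi.ne'
  have hrc : (r : ℂ) ≠ 0 := by exact_mod_cast hr
  rw [mul_div_cancel₀ _ hpc] at h
  have h2 := (h.const_mul (-Complex.I))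
  have e1 : -Complex.I * Complex.sin (Complex.I * r) = (Real.sinh r : ℝ) := by
    rw [mul_comm Complex.I, Complex.sin_mul_I, Complex.ofReal_sinh]
    linear_combination (-Complex.sinh r) * Complex.I_sq
  have e2 : ∀ N : ℕ, -Complex.I * (Complex.I * r * ∏ j ∈ Finset.range N,
      (1 - (Complex.I * r / Real.pi) ^ 2 / ((j : ℂ) + 1) ^ 2)) =
      ((r * ∏ j ∈ Finset.range N, (1 + r ^ 2 / (Real.pi * (j + 1)) ^ 2) : ℝ) : ℂ) := by
    intro N
    push_cast
    rw [← mul_assoc, ← mul_assoc]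
    congr 1
    · linear_combination (-(r : ℂ)) * Complex.I_sq
    · refine Finset.prod_congr rfl fun j _ => ?_
      rw [div_pow, mul_pow, Complex.I_sq, mul_pow]
      field_simp
      ring
  simp only [e1, e2] at h2
  have h3 := (Complex.continuous_re.tendsto _).comp h2
  simp only [Function.comp_def, Complex.ofReal_re] at h3
  have h4 := (h3.inv₀ hs).const_mul r
  rw [← div_eq_mul_inv] at h4
  refine h4.congr fun N => ?_
  rw [mul_inv, mul_inv_cancel_left₀ hr, ← Finset.prod_inv_distrib]
  refine Finset.prod_congr rfl fun j _ => ?_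
  have : (0 : ℝ) < Real.pi * (j + 1) := by positivity
  have : 0 < (Real.pi * (j + 1)) ^ 2 + r ^ 2 := by positivity
  field_simp

/-- The partial fraction expansion of `π cot (π z)` at `z = i r / π`, that is, `r coth r = 1 + 2 ∑
r² / ((πj)² + r²)`. -/
theorem tendsto_sum_rCoth (r : ℝ) :
    Tendsto (fun N => ∑ j ∈ Finset.range N, r ^ 2 / ((Real.pi * (j + 1)) ^ 2 + r ^ 2)) atTop
      (𝓝 ((rCoth r - 1) / 2)) := by
  have hpi := Real.pi_pos
  unfold rCoth wSinh
  split_ifs with hr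
  · simp [hr]
  have hs : Real.sinh r ≠ 0 := by rwa [Ne, Real.sinh_eq_zero]
  have hpc : (Real.pi : ℂ) ≠ 0 := by exact_mod_cast hpi.ne'
  have hrc : (r : ℂ) ≠ 0 := by exact_mod_cast hr
  -- The point is not an integer because its imaginary part `r / π` is nonzero.
  have hz : Complex.I * r / Real.pi ∈ Complex.integerComplement := by
    rintro ⟨k, hk⟩
    have := congrArg Complex.im hk
    have e : Complex.I * r / Real.pi = ((r / Real.pi : ℝ) : ℂ) * Complex.I := by push_cast; ring
    rw [e, Complex.im_ofReal_mul] at this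
    simp only [Complex.I_im, mul_one, Complex.intCast_im] at this
    exact div_ne_zero hr hpi.ne' this.symm
  have h := (tendsto_logDeriv_euler_cot_sub hz).const_mul (Complex.I * r / (2 * Real.pi))
  have e1 : Complex.I * r / (2 * Real.pi) * (Real.pi * Complex.cot (Real.pi * (Complex.I * r / Real.pi))
      - 1 / (Complex.I * r / Real.pi)) = (((Real.cosh r * (r / Real.sinh r) - 1) / 2 : ℝ) : ℂ) := by
    have hsc : Complex.sinh r ≠ 0 := by rw [← Complex.ofReal_sinh]; exact_mod_cast hs
    have hI := Complex.I_ne_zero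
    rw [mul_div_cancel₀ _ hpc, Complex.cot, mul_comm Complex.I, Complex.sin_mul_I, Complex.cos_mul_I]
    push_cast
    field_simp
  have e2 : ∀ N : ℕ, Complex.I * r / (2 * Real.pi) * ∑ j ∈ Finset.range N,
      cotTerm (Complex.I * r / Real.pi) j =
      ((∑ j ∈ Finset.range N, r ^ 2 / ((Real.pi * (j + 1)) ^ 2 + r ^ 2) : ℝ) : ℂ) := by
    intro N
    push_cast
    rw [Finset.mul_sum]
    refine Finset.sum_congr rfl fun j _ => ?_
    rw [cotTerm_identity hz]
    have h1 : ((Real.pi : ℂ) * (j + 1)) ^ 2 + (r : ℂ) ^ 2 ≠ 0 := by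
      have : ((Real.pi * (j + 1)) ^ 2 + r ^ 2 : ℝ) ≠ 0 := by positivity
      exact_mod_cast this
    have h2 : (Complex.I * r / Real.pi + (j + 1)) * (Complex.I * r / Real.pi - (j + 1)) =
        -(((Real.pi : ℂ) * (j + 1)) ^ 2 + (r : ℂ) ^ 2) / Real.pi ^ 2 := by
      field_simp
      linear_combination (r : ℂ) ^ 2 * Complex.I_sq
    rw [h2]
    generalize ((Real.pi : ℂ) * (j + 1)) ^ 2 + (r : ℂ) ^ 2 = D at h1 ⊢
    have h3 : Complex.I * r / (2 * Real.pi) * (2 * (Complex.I * r / Real.pi) *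
        (1 / (-D / Real.pi ^ 2))) = -(Complex.I ^ 2) * r ^ 2 / D := by
      field_simp
    rw [h3, Complex.I_sq, neg_neg, one_mul]
  have h2 := (h.congr e2)
  rw [e1] at h2
  have h3 := (Complex.continuous_re.tendsto _).comp h2
  simpa only [Function.comp_def, Complex.ofReal_re] using h3

/-- Truncating the product for `r / sinh r` and the sum for `r coth r` leaves finitely many
resolvent and exponential-resolvent factors, each of which preserves `GaussPos`. The constant term
and the doubled sum in `r coth r` account for the factor `exp (-a)` and the exponent `2 * a`. -/
theorem gaussPos_profile (n : ℕ) {a : ℝ} (ha : 0 ≤ a) :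
    GaussPos (fun l : Ver m => Real.exp (-a * rCoth ‖l‖) * wSinh ‖l‖ ^ n) := by
  have hpi := Real.pi_pos
  have hc : ∀ j : ℕ, (0 : ℝ) < (Real.pi * (j + 1)) ^ 2 := fun j => by positivity
  have hF : ∀ N : ℕ, GaussPos (fun l : Ver m => Real.exp (-a) *
      (Real.exp (-(2 * a) * ∑ j ∈ Finset.range N, ‖l‖ ^ 2 / ((Real.pi * (j + 1)) ^ 2 + ‖l‖ ^ 2)) *
      (∏ j ∈ Finset.range N, (Real.pi * (j + 1)) ^ 2 / ((Real.pi * (j + 1)) ^ 2 + ‖l‖ ^ 2)) ^ n)) := by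
    intro N
    refine GaussPos.const_mul ?_ (Real.exp_pos _).le
    induction N with
    | zero => simpa using GaussPos.const (m := m) zero_le_one
    | succ N ih =>
      convert (ih.mul_resolvent_pow (hc N) n).mul_exp_resolvent (hc N) (a := 2 * a)
        (by positivity) using 2 with l
      rw [Finset.sum_range_succ, Finset.prod_range_succ, mul_add, Real.exp_add]
      generalize (Real.pi * ((N : ℝ) + 1)) ^ 2 / ((Real.pi * (N + 1)) ^ 2 + ‖l‖ ^ 2) = q
      generalize ∏ j ∈ Finset.range N, (Real.pi * ((j : ℝ) + 1)) ^ 2 /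
        ((Real.pi * (j + 1)) ^ 2 + ‖l‖ ^ 2) = p
      rw [mul_pow]
      ring
  refine GaussPos.of_tendsto hF (C := 1) (fun N l => ?_) (fun l => ?_)
  · have h1 : ∀ j : ℕ, 0 ≤ (Real.pi * (j + 1)) ^ 2 / ((Real.pi * (j + 1)) ^ 2 + ‖l‖ ^ 2) ∧
        (Real.pi * (j + 1)) ^ 2 / ((Real.pi * (j + 1)) ^ 2 + ‖l‖ ^ 2) ≤ 1 := fun j => by
      have := hc j
      refine ⟨by positivity, ?_⟩
      rw [div_le_one (by positivity)]; nlinarith [sq_nonneg ‖l‖]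
    have h2 : 0 ≤ ∏ j ∈ Finset.range N, (Real.pi * (j + 1)) ^ 2 / ((Real.pi * (j + 1)) ^ 2 + ‖l‖ ^ 2) :=
      Finset.prod_nonneg fun j _ => (h1 j).1
    have h3 : 0 ≤ ∑ j ∈ Finset.range N, ‖l‖ ^ 2 / ((Real.pi * (j + 1)) ^ 2 + ‖l‖ ^ 2) :=
      Finset.sum_nonneg fun j _ => by positivity
    rw [abs_of_nonneg (by positivity)]
    refine mul_le_one₀ (Real.exp_le_one_iff.2 (by linarith)) (by positivity) (mul_le_one₀ ?_ (by positivity) ?_)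
    · rw [Real.exp_le_one_iff, neg_mul]
      exact neg_nonpos.2 (by positivity)
    · exact pow_le_one₀ h2 (Finset.prod_le_one (fun j _ => (h1 j).1) fun j _ => (h1 j).2)
  · have h := (((tendsto_sum_rCoth ‖l‖).const_mul (-(2 * a))).rexp.mul
      ((tendsto_prod_wSinh ‖l‖).pow n)).const_mul (Real.exp (-a))
    convert h using 2
    rw [← mul_assoc, ← Real.exp_add]
    congr 2
    ring

/-- Integrability of `φ` now allows the damping `δ = 1 / (k + 1)` to tend to zero. -/
theorem GaussPos.integral_cos_nonneg {φ : Ver m → ℝ} (hφ : GaussPos φ) (hi : Integrable φ)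
    (z : Ver m) : 0 ≤ ∫ l, Real.cos ⟪l, z⟫ * φ l := by
  have hlim : Tendsto (fun k : ℕ => ∫ l, Real.cos ⟪l, z⟫ * φ l *
      Real.exp (-(1 / ((k : ℝ) + 1)) * ‖l‖ ^ 2)) atTop (𝓝 (∫ l, Real.cos ⟪l, z⟫ * φ l)) := by
    refine tendsto_integral_of_dominated_convergence (fun l => ‖φ l‖)
      (fun k => (hφ.integrable (by positivity) z).aestronglyMeasurable) hi.norm
      (fun k => .of_forall fun l => ?_) (.of_forall fun l => ?_)
    · rw [norm_mul, norm_mul, mul_right_comm]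
      refine mul_le_of_le_one_left (norm_nonneg _) (mul_le_one₀ (Real.abs_cos_le_one _)
        (norm_nonneg _) ?_)
      rw [Real.norm_of_nonneg (Real.exp_pos _).le, Real.exp_le_one_iff, neg_mul]
      exact neg_nonpos.2 (by positivity)
    · have h := ((tendsto_one_div_add_atTop_nhds_zero_nat (𝕜 := ℝ)).neg.mul_const (‖l‖ ^ 2)).rexp.const_mul
        (Real.cos ⟪l, z⟫ * φ l)
      simpa using h
  exact ge_of_tendsto' hlim fun k => hφ.nonneg _ (by positivity) z

/-! ### The time-one kernel as a cosine transform in the centre. -/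

theorem wSinh_pos (r : ℝ) : 0 < wSinh r := by
  unfold wSinh
  split_ifs with hr
  · exact one_pos
  · rcases lt_or_gt_of_ne hr with h | h
    · exact div_pos_of_neg_of_neg h (Real.sinh_neg_iff.2 h)
    · exact div_pos h (Real.sinh_pos_iff.2 h)

theorem wSinh_le_one {r : ℝ} (hr : 0 ≤ r) : wSinh r ≤ 1 := by
  unfold wSinh
  split_ifs with h
  · exact le_rfl
  · exact div_le_one_of_le₀ (Real.self_le_sinh_iff.2 hr) (Real.sinh_nonneg_iff.2 hr)

theorem rCoth_pos (r : ℝ) : 0 < rCoth r := mul_pos (Real.cosh_pos r) (wSinh_pos r)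

theorem continuous_wSinh : Continuous wSinh := by
  -- The difference quotient of `sinh` at `0`, completed by its derivative there, is exactly the
  -- reciprocal, so the removable singularity needs no separate limit.
  have h : wSinh = fun r => (dslope Real.sinh 0 r)⁻¹ := by
    ext r
    unfold wSinh
    split_ifs with hr
    · rw [hr, dslope_same, Real.deriv_sinh, Real.cosh_zero, inv_one]
    · rw [dslope_of_ne _ hr, slope_def_field, Real.sinh_zero, sub_zero, sub_zero, inv_div]
  have hc : Continuous (dslope Real.sinh 0) :=
    continuous_iff_continuousAt.2 fun r => by
      rcases eq_or_ne r 0 with rfl | hr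
      · exact continuousAt_dslope_same.2 Real.differentiable_sinh.differentiableAt
      · exact (continuousAt_dslope_of_ne hr).2 Real.continuous_sinh.continuousAt
  rw [h]
  refine hc.inv₀ fun r hr => ?_
  have := wSinh_pos r
  rw [h] at this
  simp [hr] at this

theorem continuous_rCoth : Continuous rCoth := Real.continuous_cosh.mul continuous_wSinh

/-- The partial Fourier transform in the central variable of `(4π)ⁿ p_1`. -/
def profile (n : ℕ) (x : Hor n) (l : Ver m) : ℝ :=
  Real.exp (-(1 / 4 * ‖x‖ ^ 2) * rCoth ‖l‖) * wSinh ‖l‖ ^ n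

theorem continuous_profile_right (x : Hor n) : Continuous fun l : Ver m => profile n x l := by
  have := continuous_rCoth
  have := continuous_wSinh
  unfold profile
  fun_prop

theorem continuous_profile_left (l : Ver m) : Continuous fun x : Hor n => profile n x l := by
  have := continuous_rCoth
  have := continuous_wSinh
  unfold profile
  fun_prop

theorem profile_pos (x : Hor n) (l : Ver m) : 0 < profile n x l :=
  mul_pos (Real.exp_pos _) (pow_pos (wSinh_pos _) _)

theorem profile_le (x : Hor n) (l : Ver m) : profile n x l ≤ profile n 0 l := by
  unfold profile
  have := pow_pos (wSinh_pos ‖l‖) n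
  have := rCoth_pos ‖l‖
  gcongr
  simp

theorem profile_le_one (x : Hor n) (l : Ver m) : profile n x l ≤ 1 := by
  refine (profile_le x l).trans ?_
  simpa [profile] using pow_le_one₀ (wSinh_pos ‖l‖).le (wSinh_le_one (norm_nonneg l))

/-- The origin is excluded because division by zero gives the weight `‖l‖ / sinh ‖l‖` the value `0`
there, whereas `wSinh 0 = 1`. For `m > 0` this is a null set. -/
theorem kernelIntegrand_re {g : Grp n m} {l : Ver m} (hl : l ≠ 0) :
    (kernelIntegrand 1 g l).re = Real.cos ⟪l, g.2⟫ * profile n g.1 l := by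
  have h0 : ‖l‖ ≠ 0 := norm_ne_zero_iff.2 hl
  have h1 : 1 / 4 * (‖l‖ * coth (1 * ‖l‖)) * ‖g.1‖ ^ 2 = 1 / 4 * ‖g.1‖ ^ 2 * rCoth ‖l‖ := by
    unfold coth rCoth wSinh
    rw [if_neg h0, one_mul]; ring
  have h2 : ‖l‖ / Real.sinh (1 * ‖l‖) = wSinh ‖l‖ := by
    unfold wSinh; rw [if_neg h0, one_mul]
  unfold kernelIntegrand profile
  rw [h1, h2, Complex.re_mul_ofReal]
  have h3 : Complex.I * ((⟪l, g.2⟫ : ℝ) : ℂ) - ((1 / 4 * ‖g.1‖ ^ 2 * rCoth ‖l‖ : ℝ) : ℂ) =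
      ((-(1 / 4 * ‖g.1‖ ^ 2) * rCoth ‖l‖ : ℝ) : ℂ) + (⟪l, g.2⟫ : ℝ) * Complex.I := by
    push_cast; ring
  rw [h3, Complex.exp_add, ← Complex.ofReal_exp, Complex.re_ofReal_mul, Complex.exp_ofReal_mul_I_re]
  ring

theorem ae_ne_zero (hm : 0 < m) : ∀ᵐ l : Ver m, l ≠ 0 := by
  have hne : Nonempty (Fin m) := ⟨⟨0, hm⟩⟩
  rw [ae_iff]; simp

theorem integrable_profile (hn : 0 < n) (hm : 0 < m) (x : Hor n) :
    Integrable fun l : Ver m => profile n x l := by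
  refine (integrable_kernelIntegrand hn one_pos ((x, 0) : Grp n m)).re.congr ?_
  filter_upwards [ae_ne_zero hm] with l hl
  simpa using kernelIntegrand_re (g := ((x, 0) : Grp n m)) hl

theorem heatKernel_one (hn : 0 < n) (hm : 0 < m) (g : Grp n m) :
    heatKernel 1 g = ((2 * Real.pi) ^ m)⁻¹ * ((4 * Real.pi) ^ n)⁻¹ *
      ∫ l : Ver m, Real.cos ⟪l, g.2⟫ * profile n g.1 l := by
  unfold heatKernel
  rw [← Complex.reCLM_apply, ← ContinuousLinearMap.integral_comp_comm _
    (integrable_kernelIntegrand hn one_pos g)]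
  congr 1
  refine integral_congr_ae ?_
  filter_upwards [ae_ne_zero hm] with l hl
  exact kernelIntegrand_re hl

theorem integral_cos_profile_nonneg (hn : 0 < n) (hm : 0 < m) (x : Hor n) (z : Ver m) :
    0 ≤ ∫ l : Ver m, Real.cos ⟪l, z⟫ * profile n x l :=
  (gaussPos_profile n (by positivity)).integral_cos_nonneg (integrable_profile hn hm x) z

theorem heatKernel_one_nonneg (hn : 0 < n) (hm : 0 < m) (g : Grp n m) : 0 ≤ heatKernel 1 g := by
  rw [heatKernel_one hn hm]
  have := integral_cos_profile_nonneg hn hm g.1 g.2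
  positivity

theorem norm_cos_mul_le (a b : ℝ) : ‖Real.cos a * b‖ ≤ ‖b‖ := by
  rw [norm_mul]
  exact mul_le_of_le_one_left (norm_nonneg _) (Real.abs_cos_le_one _)

theorem continuous_heatKernel_one (hn : 0 < n) (hm : 0 < m) :
    Continuous (heatKernel 1 : Grp n m → ℝ) := by
  have h : (heatKernel 1 : Grp n m → ℝ) = fun g => ((2 * Real.pi) ^ m)⁻¹ * ((4 * Real.pi) ^ n)⁻¹ *
      ∫ l : Ver m, Real.cos ⟪l, g.2⟫ * profile n g.1 l := funext (heatKernel_one hn hm)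
  rw [h]
  refine continuous_const.mul (continuous_of_dominated (bound := fun l => profile n (0 : Hor n) l)
    (fun g => ?_) (fun g => .of_forall fun l => ?_) (integrable_profile hn hm 0)
    (.of_forall fun l => ?_))
  · have := continuous_profile_right (m := m) g.1
    exact Continuous.aestronglyMeasurable (by fun_prop)
  · refine (norm_cos_mul_le _ _).trans ?_
    rw [Real.norm_of_nonneg (profile_pos _ _).le]
    exact profile_le _ _
  · have := (continuous_profile_left (n := n) l).comp (continuous_fst (Y := Ver m))
    simp only [Function.comp_def] at this
    fun_prop

/-! ### Integrability and Fourier inversion in the centre. -/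

/-- A bounded integrable function with nonnegative Fourier transform has integrable Fourier
transform. -/
theorem integrable_cosTransform {φ : Ver m → ℝ} (hc : Continuous φ) (hi : Integrable φ) {C : ℝ}
    (hC : ∀ l, |φ l| ≤ C) (hpos : ∀ z, 0 ≤ ∫ l, Real.cos ⟪l, z⟫ * φ l) :
    Integrable fun z => ∫ l, Real.cos ⟪l, z⟫ * φ l := by
  set q : Ver m → ℝ := fun z => ∫ l, Real.cos ⟪l, z⟫ * φ l with hq
  have hqc : Continuous q := continuous_of_dominated (bound := fun l => ‖φ l‖)
    (fun g => Continuous.aestronglyMeasurable (by fun_prop))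
    (fun g => .of_forall fun l => norm_cos_mul_le _ _) hi.norm (.of_forall fun l => by fun_prop)
  have hqb : ∀ z, q z ≤ ∫ l, ‖φ l‖ := fun z =>
    (le_abs_self _).trans ((norm_integral_le_integral_norm _).trans
      (integral_mono_of_nonneg (.of_forall fun l => norm_nonneg _) hi.norm
        (.of_forall fun l => norm_cos_mul_le _ _)))
  -- Fubini moves the transform onto the Gaussian. The transformed Gaussian has total mass `(2π)ᵐ`
  -- whatever `ε` is, so the bound is uniform.
  have hgauss : ∀ ε > 0, Integrable (fun z => Real.exp (-ε * ‖z‖ ^ 2) * q z) ∧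
      ∫ z, Real.exp (-ε * ‖z‖ ^ 2) * q z ≤ C * (2 * Real.pi) ^ m := by
    intro ε hε
    have hpi := Real.pi_pos
    constructor
    · refine ((integrable_gaussian hε).mul_const (∫ l, ‖φ l‖)).mono'
        (Continuous.aestronglyMeasurable (by fun_prop)) (.of_forall fun z => ?_)
      rw [norm_mul, Real.norm_of_nonneg (Real.exp_pos _).le, Real.norm_of_nonneg (hpos z)]
      exact mul_le_mul_of_nonneg_left (hqb z) (Real.exp_pos _).le
    · have e1 : ∀ z, Real.exp (-ε * ‖z‖ ^ 2) * q z =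
          ∫ l, φ l * (Real.cos ⟪l, z⟫ * Real.exp (-ε * ‖z‖ ^ 2)) := fun z => by
        rw [hq, ← integral_const_mul]; congr 1; ext l; ring
      have e2 : ∀ l : Ver m, ∫ z : Ver m, φ l * (Real.cos ⟪l, z⟫ * Real.exp (-ε * ‖z‖ ^ 2)) =
          φ l * ((Real.pi / ε) ^ (m / 2 : ℝ) * Real.exp (-(1 / (4 * ε)) * ‖l‖ ^ 2)) := fun l => by
        rw [integral_const_mul]
        have := integral_cos_mul_gaussian hε l
        simp only [real_inner_comm l] at this ⊢
        rw [this]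
        congr 3; ring
      simp only [e1]
      rw [integral_integral_swap]
      · simp only [e2]
        have hb : 0 < 1 / (4 * ε) := by positivity
        have hg := (integrable_gaussian (ι := Fin m) hb).const_mul ((Real.pi / ε) ^ (m / 2 : ℝ))
        have h1 := GaussianFourier.integral_rexp_neg_mul_sq_norm (V := Ver m) hb
        calc _ ≤ ∫ l : Ver m, C * ((Real.pi / ε) ^ (m / 2 : ℝ) * Real.exp (-(1 / (4 * ε)) * ‖l‖ ^ 2)) := by
              refine integral_mono (hg.bdd_mul (c := C) hc.aestronglyMeasurable
                (.of_forall hC)) (hg.const_mul C) fun l => ?_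
              have := (le_abs_self _).trans (hC l)
              dsimp only
              gcongr
          _ = C * (2 * Real.pi) ^ m := by
              rw [integral_const_mul, integral_const_mul, h1, finrank_euclideanSpace_fin,
                ← Real.mul_rpow (by positivity) (by positivity)]
              have : Real.pi / ε * (Real.pi / (1 / (4 * ε))) = (2 * Real.pi) ^ 2 := by
                field_simp; ring
              rw [this, ← Real.rpow_natCast (2 * Real.pi) 2, ← Real.rpow_mul (by positivity),
                ← Real.rpow_natCast]
              congr 2; push_cast; ring
      · refine ((integrable_gaussian hε).mul_prod hi.norm).mono'
          (Continuous.aestronglyMeasurable ?_) (.of_forall fun p => ?_)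
        · unfold Function.uncurry; fun_prop
        · simp only [Function.uncurry]
          rw [norm_mul, mul_comm]
          exact mul_le_mul_of_nonneg_right ((norm_cos_mul_le _ _).trans_eq
              (Real.norm_of_nonneg (Real.exp_pos _).le)) (norm_nonneg _)
  refine (aecover_closedBall (tendsto_natCast_atTop_atTop (R := ℝ)) (x := (0 : Ver m))).integrable_of_integral_bounded_of_nonneg_ae
    (Real.exp 1 * (C * (2 * Real.pi) ^ m)) (fun k => hqc.continuousOn.integrableOn_compact (isCompact_closedBall _ _))
    (.of_forall hpos) (.of_forall fun k => ?_)
  -- On the ball of radius `k` this damping is at least `e⁻¹`, so undoing it costs a factor `e`;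
  -- nonnegativity of `q` extends the integral to the whole space.
  have hε : (0 : ℝ) < 1 / ((k : ℝ) ^ 2 + 1) := by positivity
  obtain ⟨h1, h2⟩ := hgauss _ hε
  calc ∫ z in Metric.closedBall 0 (k : ℝ), q z ≤
        ∫ z in Metric.closedBall 0 (k : ℝ), Real.exp 1 * (Real.exp (-(1 / ((k : ℝ) ^ 2 + 1)) * ‖z‖ ^ 2) * q z) := by
        refine setIntegral_mono_on (hqc.continuousOn.integrableOn_compact (isCompact_closedBall _ _))
          (h1.const_mul _).integrableOn measurableSet_closedBall fun z hz => ?_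
        rw [mem_closedBall_zero_iff] at hz
        rw [← mul_assoc, ← Real.exp_add]
        refine le_mul_of_one_le_left (hpos z) (Real.one_le_exp ?_)
        have : 1 / ((k : ℝ) ^ 2 + 1) * ‖z‖ ^ 2 ≤ 1 := by
          rw [one_div_mul_eq_div, div_le_one (by positivity)]
          nlinarith [norm_nonneg z]
        linarith
    _ ≤ ∫ z, Real.exp 1 * (Real.exp (-(1 / ((k : ℝ) ^ 2 + 1)) * ‖z‖ ^ 2) * q z) :=
        setIntegral_le_integral (h1.const_mul _) (.of_forall fun z => by
          have := hpos z
          exact mul_nonneg (Real.exp_pos _).le (mul_nonneg (Real.exp_pos _).le this))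
    _ ≤ _ := by
        rw [integral_const_mul]
        gcongr

open scoped FourierTransform in
-- Fourier inversion, valid pointwise because the transform is integrable. Evenness removes the sine
-- part, and passing from the `e^{-2πi⟨v,w⟩}` normalisation produces `(2π)ᵐ`.
theorem integral_cos_cosTransform {φ : Ver m → ℝ} (hc : Continuous φ) (hi : Integrable φ) {C : ℝ}
    (hC : ∀ l, |φ l| ≤ C) (hpos : ∀ z, 0 ≤ ∫ l, Real.cos ⟪l, z⟫ * φ l) (heven : ∀ l, φ (-l) = φ l)
    (μ : Ver m) :
    ∫ z, Real.cos ⟪μ, z⟫ * ∫ l, Real.cos ⟪l, z⟫ * φ l = (2 * Real.pi) ^ m * φ μ := by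
  have hpi := Real.pi_pos
  have hq := integrable_cosTransform hc hi hC hpos
  set q : Ver m → ℝ := fun z => ∫ l, Real.cos ⟪l, z⟫ * φ l with hqdef
  have hF : 𝓕 (fun l => (φ l : ℂ)) = fun w => ((q ((2 * Real.pi) • w) : ℝ) : ℂ) := by
    ext w
    rw [Real.fourier_eq']
    have hint : Integrable fun v : Ver m =>
        Complex.exp (((-2 * Real.pi * ⟪v, w⟫ : ℝ) : ℂ) * Complex.I) • (φ v : ℂ) := by
      refine hi.ofReal.bdd_mul (c := 1) (Continuous.aestronglyMeasurable (by fun_prop))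
        (.of_forall fun v => ?_)
      rw [Complex.norm_exp_ofReal_mul_I]
    apply Complex.ext
    · rw [← Complex.reCLM_apply, ← ContinuousLinearMap.integral_comp_comm _ hint, Complex.ofReal_re]
      refine integral_congr_ae (.of_forall fun v => ?_)
      simp only [Complex.reCLM_apply, smul_eq_mul, Complex.re_mul_ofReal, Complex.exp_ofReal_mul_I_re,
        inner_smul_right]
      rw [neg_mul, neg_mul, Real.cos_neg]
    · rw [← Complex.imCLM_apply, ← ContinuousLinearMap.integral_comp_comm _ hint, Complex.ofReal_im]
      simp only [Complex.imCLM_apply, smul_eq_mul, Complex.im_mul_ofReal, Complex.exp_ofReal_mul_I_im]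
      have h := integral_neg_eq_self (fun v : Ver m => Real.sin (-2 * Real.pi * ⟪v, w⟫) * φ v) volume
      simp only [heven, inner_neg_left, mul_neg, Real.sin_neg, neg_mul, integral_neg] at h ⊢
      linarith
  have h2pi : (2 * Real.pi) ≠ 0 := by positivity
  have hFi : Integrable (𝓕 (fun l => (φ l : ℂ))) := by
    rw [hF]
    exact ((integrable_comp_smul_iff volume q h2pi).2 hq).ofReal
  have hinv := hi.ofReal.fourierInv_fourier_eq hFi (v := μ) (by fun_prop)
  rw [hF, Real.fourierInv_eq'] at hinv
  have hint : Integrable fun w : Ver m =>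
      Complex.exp (((2 * Real.pi * ⟪w, μ⟫ : ℝ) : ℂ) * Complex.I) • ((q ((2 * Real.pi) • w) : ℝ) : ℂ) := by
    rw [hF] at hFi
    refine hFi.bdd_mul (c := 1) (Continuous.aestronglyMeasurable (by fun_prop))
      (.of_forall fun v => ?_)
    rw [Complex.norm_exp_ofReal_mul_I]
  have hre := congrArg Complex.re hinv
  rw [← Complex.reCLM_apply, ← ContinuousLinearMap.integral_comp_comm _ hint] at hre
  simp only [Complex.reCLM_apply, smul_eq_mul, Complex.re_mul_ofReal, Complex.exp_ofReal_mul_I_re,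
    Complex.ofReal_re] at hre
  have hsub := Measure.integral_comp_smul (volume : Measure (Ver m))
    (fun z => Real.cos ⟪μ, z⟫ * q z) (2 * Real.pi)
  simp only [inner_smul_right, real_inner_comm μ] at hsub hre
  rw [hre, finrank_euclideanSpace_fin, abs_of_nonneg (by positivity), smul_eq_mul] at hsub
  rw [hsub, mul_inv_cancel_left₀ (by positivity)]

/-! ### Marginals and moments of the time-one kernel. -/

/-- The marginal of `p_1` in the horizontal variable. -/
def gaussWeight (n : ℕ) (x : Hor n) : ℝ :=
  ((4 * Real.pi) ^ n)⁻¹ * Real.exp (-(1 / 4) * ‖x‖ ^ 2)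

theorem gaussWeight_pos (x : Hor n) : 0 < gaussWeight n x := by
  have := Real.pi_pos
  unfold gaussWeight; positivity

theorem continuous_gaussWeight : Continuous (gaussWeight n) := by
  unfold gaussWeight; fun_prop

theorem gaussWeight_eq_profile (x : Hor n) :
    gaussWeight n x = ((4 * Real.pi) ^ n)⁻¹ * profile n x (0 : Ver m) := by
  unfold gaussWeight profile rCoth wSinh
  simp

/-- Inverting the transform in `z` returns the profile. At `μ = 0` this is the Gaussian marginal;
general `μ` leads to the characteristic function and the central moments. -/
theorem heatKernel_one_right (hn : 0 < n) (hm : 0 < m) (x : Hor n) :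
    Integrable (fun z : Ver m => heatKernel 1 (x, z)) ∧ ∀ μ : Ver m,
      ∫ z : Ver m, Real.cos ⟪μ, z⟫ * heatKernel 1 (x, z) = ((4 * Real.pi) ^ n)⁻¹ * profile n x μ := by
  have hpi := Real.pi_pos
  have hb : ∀ l : Ver m, |profile n x l| ≤ 1 := fun l => by
    rw [abs_of_pos (profile_pos x l)]; exact profile_le_one x l
  have he : ∀ l : Ver m, profile n x (-l) = profile n x l := fun l => by
    unfold profile; rw [norm_neg]
  have hpos := integral_cos_profile_nonneg hn hm x
  have hc := continuous_profile_right (m := m) x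
  have hi := integrable_profile hn hm x
  simp only [heatKernel_one hn hm]
  refine ⟨(integrable_cosTransform hc hi hb hpos).const_mul _, fun μ => ?_⟩
  have h := integral_cos_cosTransform hc hi hb hpos he μ
  simp only [mul_left_comm (Real.cos _)]
  rw [integral_const_mul, h]
  field_simp

theorem integral_heatKernel_one_right (hn : 0 < n) (hm : 0 < m) (x : Hor n) :
    ∫ z : Ver m, heatKernel 1 (x, z) = gaussWeight n x := by
  have h := (heatKernel_one_right hn hm x).2 0
  simpa [gaussWeight_eq_profile (m := m)] using h

/-- As the kernel is nonnegative, integrating the absolute value over `z` gives `|h|` times the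
marginal, and Tonelli reduces the claim to `ℝ²ⁿ`. -/
theorem integrable_fst_mul_heatKernel (hn : 0 < n) (hm : 0 < m) {h : Hor n → ℝ}
    (hc : Continuous h) (hi : Integrable fun x => h x * gaussWeight n x) :
    Integrable fun g : Grp n m => h g.1 * heatKernel 1 g := by
  have hk := continuous_heatKernel_one (n := n) (m := m) hn hm
  have hmeas : AEStronglyMeasurable (fun g : Grp n m => h g.1 * heatKernel 1 g) :=
    Continuous.aestronglyMeasurable (by fun_prop)
  rw [Measure.volume_eq_prod] at hmeas ⊢
  rw [integrable_prod_iff hmeas]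
  refine ⟨.of_forall fun x => (heatKernel_one_right hn hm x).1.const_mul (h x), ?_⟩
  refine hi.norm.congr (.of_forall fun x => ?_)
  simp only [norm_mul, Real.norm_of_nonneg (gaussWeight_pos x).le,
    Real.norm_of_nonneg (heatKernel_one_nonneg hn hm _), integral_const_mul,
    integral_heatKernel_one_right hn hm]

theorem integral_fst_mul_heatKernel (hn : 0 < n) (hm : 0 < m) {h : Hor n → ℝ}
    (hc : Continuous h) (hi : Integrable fun x => h x * gaussWeight n x) :
    ∫ g : Grp n m, h g.1 * heatKernel 1 g = ∫ x, h x * gaussWeight n x := by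
  have := integrable_fst_mul_heatKernel (m := m) hn hm hc hi
  rw [Measure.volume_eq_prod] at this ⊢
  rw [integral_prod _ this]
  simp only [integral_const_mul, integral_heatKernel_one_right hn hm]

theorem integrable_norm_pow_mul_gaussWeight (k : ℕ) :
    Integrable fun x : Hor n => ‖x‖ ^ (2 * k) * gaussWeight n x := by
  have hpi := Real.pi_pos
  refine ((integrable_gaussian (ι := Fin (2 * n)) (b := 1 / 8) (by norm_num)).const_mul
    (k.factorial * 8 ^ k * ((4 * Real.pi) ^ n)⁻¹)).mono' (Continuous.aestronglyMeasurable ?_)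
    (.of_forall fun x => ?_)
  · have := continuous_gaussWeight (n := n)
    fun_prop
  · rw [Real.norm_of_nonneg (mul_nonneg (by positivity) (gaussWeight_pos x).le)]
    -- Half of the Gaussian decay is spent on the polynomial, through `yᵏ / k! ≤ eʸ` with `y = |x|²
    -- / 8`.
    have h := Real.pow_div_factorial_le_exp (1 / 8 * ‖x‖ ^ 2) (by positivity) k
    rw [div_le_iff₀ (by positivity)] at h
    have h1 : Real.exp (-(1 / 4) * ‖x‖ ^ 2) = Real.exp (-(1 / 8) * ‖x‖ ^ 2) * Real.exp (-(1 / 8) * ‖x‖ ^ 2) := by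
      rw [← Real.exp_add]; ring_nf
    have h2 : Real.exp (1 / 8 * ‖x‖ ^ 2) * Real.exp (-(1 / 8) * ‖x‖ ^ 2) = 1 := by
      rw [← Real.exp_add]; ring_nf; exact Real.exp_zero
    have h3 : ‖x‖ ^ (2 * k) = 8 ^ k * (1 / 8 * ‖x‖ ^ 2) ^ k := by
      rw [pow_mul, ← mul_pow]; congr 1; ring
    unfold gaussWeight
    rw [h1, h3]
    calc _ ≤ 8 ^ k * (Real.exp (1 / 8 * ‖x‖ ^ 2) * k.factorial) * (((4 * Real.pi) ^ n)⁻¹ *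
          (Real.exp (-(1 / 8) * ‖x‖ ^ 2) * Real.exp (-(1 / 8) * ‖x‖ ^ 2))) := by gcongr
      _ = k.factorial * 8 ^ k * ((4 * Real.pi) ^ n)⁻¹ * Real.exp (-(1 / 8) * ‖x‖ ^ 2) *
          (Real.exp (1 / 8 * ‖x‖ ^ 2) * Real.exp (-(1 / 8) * ‖x‖ ^ 2)) := by ring
      _ = _ := by rw [h2, mul_one]

theorem integral_gaussWeight : ∫ x : Hor n, gaussWeight n x = 1 := by
  have hpi := Real.pi_pos
  have h := GaussianFourier.integral_rexp_neg_mul_sq_norm (V := Hor n) (b := 1 / 4) (by norm_num)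
  unfold gaussWeight
  rw [integral_const_mul, h, finrank_euclideanSpace_fin]
  have : Real.pi / (1 / 4) = 4 * Real.pi := by ring
  rw [this, Nat.cast_mul, Nat.cast_ofNat, mul_div_cancel_left₀ _ (two_ne_zero), Real.rpow_natCast]
  exact inv_mul_cancel₀ (by positivity)

/-- In polar coordinates the moments are Gamma integrals, and the recursion is `Γ(n+k+1) = (n+k)
Γ(n+k)`. -/
theorem integral_norm_pow_succ_mul_gaussWeight (hn : 0 < n) (k : ℕ) :
    ∫ x : Hor n, ‖x‖ ^ (2 * (k + 1)) * gaussWeight n x =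
      4 * (n + k) * ∫ x : Hor n, ‖x‖ ^ (2 * k) * gaussWeight n x := by
  have hne : Nontrivial (Hor n) := by
    have : Nonempty (Fin (2 * n)) := ⟨⟨0, by omega⟩⟩
    infer_instance
  have key : ∀ k : ℕ, ∫ y in Ioi (0 : ℝ), y ^ (2 * n - 1) • (y ^ (2 * k) *
      (((4 * Real.pi) ^ n)⁻¹ * Real.exp (-(1 / 4) * y ^ 2))) =
      ((4 * Real.pi) ^ n)⁻¹ * (4 ^ (n + k) * (1 / 2) * Real.Gamma (n + k)) := by
    intro k
    have h := integral_rpow_mul_exp_neg_mul_rpow (p := 2) (q := (2 * n - 1 + 2 * k : ℕ)) (b := 1 / 4)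
      (by norm_num) (lt_of_lt_of_le (by norm_num) (Nat.cast_nonneg _)) (by norm_num)
    have e1 : (((2 * n - 1 + 2 * k : ℕ) : ℝ) + 1) / 2 = n + k := by
      -- The natural subtraction is harmless because `n > 0`.
      have : (2 * n - 1 + 2 * k : ℕ) + 1 = 2 * (n + k) := by omega
      have h2 : (((2 * n - 1 + 2 * k : ℕ) : ℝ) + 1) = 2 * (n + k) := by exact_mod_cast this
      rw [h2]; ring
    have e2 : (1 / 4 : ℝ) ^ (-(n + k : ℝ)) = 4 ^ (n + k) := by
      rw [one_div, Real.inv_rpow (by norm_num), Real.rpow_neg (by norm_num), inv_inv]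
      exact_mod_cast Real.rpow_natCast 4 (n + k)
    rw [neg_div, e1, e2] at h
    rw [← h, ← integral_const_mul]
    refine setIntegral_congr_fun measurableSet_Ioi fun y hy => ?_
    simp only [Real.rpow_natCast, smul_eq_mul, pow_add]
    rw [← Real.rpow_natCast y 2]
    push_cast
    ring
  have hpol : ∀ k : ℕ, ∫ x : Hor n, ‖x‖ ^ (2 * k) * gaussWeight n x = _ := fun k =>
    integral_fun_norm_addHaar (volume : Measure (Hor n)) fun y : ℝ => y ^ (2 * k) *
      (((4 * Real.pi) ^ n)⁻¹ * Real.exp (-(1 / 4) * y ^ 2))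
  rw [hpol, hpol, finrank_euclideanSpace_fin, key, key]
  have hG : Real.Gamma (n + (k + 1 : ℕ)) = (n + k) * Real.Gamma (n + k) := by
    have : (n : ℝ) + (k + 1 : ℕ) = n + k + 1 := by push_cast; ring
    rw [this, Real.Gamma_add_one (by positivity)]
  rw [hG, ← add_assoc, pow_succ]
  simp only [nsmul_eq_mul, smul_eq_mul]
  ring

theorem integral_norm_sq_mul_gaussWeight (hn : 0 < n) :
    ∫ x : Hor n, ‖x‖ ^ 2 * gaussWeight n x = 4 * n := by
  have h := integral_norm_pow_succ_mul_gaussWeight hn 0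
  simpa [integral_gaussWeight] using h

theorem integral_norm_pow_four_mul_gaussWeight (hn : 0 < n) :
    ∫ x : Hor n, ‖x‖ ^ 4 * gaussWeight n x = 16 * n * (n + 1) := by
  have h := integral_norm_pow_succ_mul_gaussWeight hn 1
  norm_num at h
  rw [h, integral_norm_sq_mul_gaussWeight hn]
  ring

/-- Directional second moments of radial weights. -/
theorem integral_inner_sq_mul_radial {ρ : ℝ → ℝ} {k : ℕ}
    (hi : ∀ v : Hor n, Integrable fun x : Hor n => ⟪x, v⟫ ^ 2 * ρ ‖x‖) {v : Hor n} (hv : ‖v‖ = 1)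
    (hk : k = 2 * n) :
    k * ∫ x : Hor n, ⟪x, v⟫ ^ 2 * ρ ‖x‖ = ∫ x : Hor n, ‖x‖ ^ 2 * ρ ‖x‖ := by
  have hsym : ∀ w : Hor n, ‖w‖ = 1 →
      ∫ x : Hor n, ⟪x, w⟫ ^ 2 * ρ ‖x‖ = ∫ x : Hor n, ⟪x, v⟫ ^ 2 * ρ ‖x‖ := by
    intro w hw
    -- Reflection in the hyperplane orthogonal to `v - w` exchanges the two unit vectors and
    -- preserves the norm and the measure, so all directions have the same second moment; summing
    -- over a basis gives the radial one.
    set U := (ℝ ∙ (v - w))ᗮ.reflection with hU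
    have hUv : U v = w := Submodule.reflection_sub (hv.trans hw.symm)
    rw [← U.measurePreserving.integral_comp U.toHomeomorph.measurableEmbedding]
    refine integral_congr_ae (.of_forall fun x => ?_)
    simp only [U.norm_map]
    rw [← hUv, U.inner_map_map]
  have hsum : ∀ x : Hor n, ‖x‖ ^ 2 * ρ ‖x‖ =
      ∑ i, ⟪x, EuclideanSpace.single i 1⟫ ^ 2 * ρ ‖x‖ := fun x => by
    rw [← Finset.sum_mul, EuclideanSpace.real_norm_sq_eq]
    simp [EuclideanSpace.inner_single_right]
  simp only [hsum]
  rw [integral_finsetSum _ fun i _ => hi _, Finset.sum_congr rfl fun i _ => hsym _ (by simp)]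
  simp [hk]

theorem integrable_inner_sq_norm_pow_mul_gaussWeight (v : Hor n) (k : ℕ) :
    Integrable fun x : Hor n => ⟪x, v⟫ ^ 2 * (‖x‖ ^ (2 * k) * gaussWeight n x) := by
  have hc := continuous_gaussWeight (n := n)
  refine ((integrable_norm_pow_mul_gaussWeight (n := n) (k + 1)).const_mul (‖v‖ ^ 2)).mono'
    (Continuous.aestronglyMeasurable (by fun_prop)) (.of_forall fun x => ?_)
  have hw := gaussWeight_pos x
  rw [Real.norm_of_nonneg (by positivity)]
  have h := abs_real_inner_le_norm x v
  have h2 : ⟪x, v⟫ ^ 2 ≤ (‖x‖ * ‖v‖) ^ 2 := sq_le_sq' (by linarith [neg_abs_le ⟪x, v⟫]) ((le_abs_self _).trans h)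
  calc _ ≤ (‖x‖ * ‖v‖) ^ 2 * (‖x‖ ^ (2 * k) * gaussWeight n x) := by gcongr
    _ = _ := by ring

theorem integral_inner_sq_mul_gaussWeight (hn : 0 < n) {v : Hor n} (hv : ‖v‖ = 1) :
    ∫ x : Hor n, ⟪x, v⟫ ^ 2 * gaussWeight n x = 2 := by
  have h := integral_inner_sq_mul_radial
    (ρ := fun r => ((4 * Real.pi) ^ n)⁻¹ * Real.exp (-(1 / 4) * r ^ 2))
    (fun v => by simpa [gaussWeight] using integrable_inner_sq_norm_pow_mul_gaussWeight v 0) hv rfl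
  have h2 := integral_norm_sq_mul_gaussWeight hn
  unfold gaussWeight at h2 ⊢
  rw [h2] at h
  have : (0 : ℝ) < n := by exact_mod_cast hn
  push_cast at h
  nlinarith

theorem integral_inner_sq_norm_sq_mul_gaussWeight (hn : 0 < n) {v : Hor n} (hv : ‖v‖ = 1) :
    ∫ x : Hor n, ⟪x, v⟫ ^ 2 * ‖x‖ ^ 2 * gaussWeight n x = 8 * (n + 1) := by
  have h := integral_inner_sq_mul_radial
    (ρ := fun r => r ^ 2 * (((4 * Real.pi) ^ n)⁻¹ * Real.exp (-(1 / 4) * r ^ 2)))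
    (fun v => by simpa [gaussWeight] using integrable_inner_sq_norm_pow_mul_gaussWeight v 1) hv rfl
  have h2 := integral_norm_pow_four_mul_gaussWeight hn
  unfold gaussWeight at h2 ⊢
  simp only [← mul_assoc, ← pow_add] at h h2 ⊢
  rw [h2] at h
  have : (0 : ℝ) < n := by exact_mod_cast hn
  push_cast at h
  have h3 : (2 * n : ℝ) ≠ 0 := by positivity
  apply mul_left_cancel₀ h3
  rw [h]
  ring

theorem integrable_heatKernel_one (hn : 0 < n) (hm : 0 < m) :
    Integrable (heatKernel 1 : Grp n m → ℝ) := by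
  simpa using integrable_fst_mul_heatKernel (m := m) hn hm (h := fun _ => 1) continuous_const
    (by simpa using integrable_norm_pow_mul_gaussWeight (n := n) 0)

theorem integral_heatKernel_one (hn : 0 < n) (hm : 0 < m) :
    ∫ g : Grp n m, heatKernel 1 g = 1 := by
  have := integral_fst_mul_heatKernel (m := m) hn hm (h := fun _ => 1) continuous_const
    (by simpa using integrable_norm_pow_mul_gaussWeight (n := n) 0)
  simpa [integral_gaussWeight] using this

/-- The profile is Gaussian in `x`, and its integral leaves `(wSinh / rCoth)ⁿ`, which is `cosh⁻ⁿ` by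
the definition of `rCoth`. -/
theorem integral_cos_mul_heatKernel_one (hn : 0 < n) (hm : 0 < m) (μ : Ver m) :
    ∫ g : Grp n m, Real.cos ⟪μ, g.2⟫ * heatKernel 1 g = (Real.cosh ‖μ‖ ^ n)⁻¹ := by
  have hpi := Real.pi_pos
  have hk := continuous_heatKernel_one (n := n) (m := m) hn hm
  have hi : Integrable fun g : Grp n m => Real.cos ⟪μ, g.2⟫ * heatKernel 1 g :=
    (integrable_heatKernel_one hn hm).mono (Continuous.aestronglyMeasurable (by fun_prop))
      (.of_forall fun g => norm_cos_mul_le _ _)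
  rw [Measure.volume_eq_prod] at hi ⊢
  rw [integral_prod _ hi]
  simp only [(heatKernel_one_right hn hm _).2]
  have hw := wSinh_pos ‖μ‖
  have hc := Real.cosh_pos ‖μ‖
  have hb : 0 < 1 / 4 * rCoth ‖μ‖ := by have := rCoth_pos ‖μ‖; positivity
  have h := GaussianFourier.integral_rexp_neg_mul_sq_norm (V := Hor n) hb
  have e : ∀ x : Hor n, profile n x μ = Real.exp (-(1 / 4 * rCoth ‖μ‖) * ‖x‖ ^ 2) * wSinh ‖μ‖ ^ n := by
    intro x
    unfold profile
    congr 2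
    ring
  simp only [e]
  rw [integral_const_mul, integral_mul_const, h, finrank_euclideanSpace_fin, Nat.cast_mul,
    Nat.cast_ofNat, mul_div_cancel_left₀ _ (two_ne_zero), Real.rpow_natCast, ← mul_pow, ← inv_pow,
    ← mul_pow, ← inv_pow]
  congr 1
  unfold rCoth
  field_simp

/-- The central second moment of `p_1`. -/
theorem integral_inner_snd_sq_mul_heatKernel_one (hn : 0 < n) (hm : 0 < m) {u : Ver m}
    (hu : ‖u‖ = 1) :
    Integrable (fun g : Grp n m => ⟪u, g.2⟫ ^ 2 * heatKernel 1 g) ∧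
      ∫ g : Grp n m, ⟪u, g.2⟫ ^ 2 * heatKernel 1 g ≤ n := by
  have hk := continuous_heatKernel_one (n := n) (m := m) hn hm
  have hk0 := heatKernel_one_nonneg (n := n) (m := m) hn hm
  have hkI := integrable_heatKernel_one (n := n) (m := m) hn hm
  -- With `ε = 1 / (k + 1)` this is `2 ε⁻² (1 - cos (ε⟨u,z⟩)) p_1`, a nonnegative approximation of
  -- `⟨u,z⟩² p_1` whose integral is known from the characteristic function.
  set F : ℕ → Grp n m → ℝ := fun k g =>
    2 * (k + 1) ^ 2 * (1 - Real.cos (⟪((1 : ℝ) / ((k : ℝ) + 1)) • u, g.2⟫)) * heatKernel 1 g with hF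
  have hF0 : ∀ k g, 0 ≤ F k g := fun k g => mul_nonneg (mul_nonneg (by positivity)
    (sub_nonneg.2 (Real.cos_le_one _))) (hk0 g)
  have hcosI : ∀ μ : Ver m, Integrable fun g : Grp n m => Real.cos ⟪μ, g.2⟫ * heatKernel 1 g :=
    fun μ => hkI.mono (Continuous.aestronglyMeasurable (by fun_prop))
      (.of_forall fun g => norm_cos_mul_le _ _)
  have hFe : ∀ k, F k = fun g => 2 * ((k : ℝ) + 1) ^ 2 * (heatKernel 1 g -
      Real.cos (⟪((1 : ℝ) / ((k : ℝ) + 1)) • u, g.2⟫) * heatKernel 1 g) := fun k => by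
    ext g; simp only [hF]; ring
  have hFI : ∀ k, Integrable (F k) := fun k => by
    rw [hFe]
    exact (hkI.sub (hcosI _)).const_mul _
  have hFb : ∀ k, ∫ g, F k g ≤ n := fun k => by
    rw [hFe, integral_const_mul, integral_sub hkI (hcosI _), integral_heatKernel_one hn hm,
      integral_cos_mul_heatKernel_one hn hm, norm_smul, hu, mul_one, Real.norm_of_nonneg (by positivity)]
    set ε : ℝ := 1 / ((k : ℝ) + 1) with hε
    -- From `cosh ε ≤ exp (ε² / 2)` and `1 - y ≤ e⁻ʸ`; it bounds every integral of `F k` by `n`.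
    have h1 : (Real.cosh ε ^ n)⁻¹ ≥ 1 - n * (ε ^ 2 / 2) := by
      have h2 : Real.cosh ε ^ n ≤ Real.exp (n * (ε ^ 2 / 2)) := by
        rw [Real.exp_nat_mul]
        have := Real.cosh_pos ε
        gcongr
        exact Real.cosh_le_exp_half_sq ε
      calc (1 : ℝ) - n * (ε ^ 2 / 2) ≤ Real.exp (-(n * (ε ^ 2 / 2))) := by
            have := Real.add_one_le_exp (-(n * (ε ^ 2 / 2))); linarith
        _ = (Real.exp (n * (ε ^ 2 / 2)))⁻¹ := Real.exp_neg _
        _ ≤ _ := by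
            have := Real.cosh_pos ε
            gcongr
    have h3 : ((k : ℝ) + 1) ^ 2 * ε ^ 2 = 1 := by
      rw [hε]; field_simp
    calc _ ≤ 2 * ((k : ℝ) + 1) ^ 2 * (n * (ε ^ 2 / 2)) := by
          gcongr; linarith
      _ = n * (((k : ℝ) + 1) ^ 2 * ε ^ 2) := by ring
      _ = n := by rw [h3, mul_one]
  have hlim : ∀ g : Grp n m, Tendsto (fun k => F k g) atTop (𝓝 (⟪u, g.2⟫ ^ 2 * heatKernel 1 g)) := by
    intro g
    refine Tendsto.mul_const _ ?_
    set y := ⟪u, g.2⟫ with hy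
    have e : ∀ k : ℕ, 2 * ((k : ℝ) + 1) ^ 2 * (1 - Real.cos (⟪((1 : ℝ) / ((k : ℝ) + 1)) • u, g.2⟫)) =
        (2 * ((k : ℝ) + 1) * Real.sin (y / 2 * (1 / ((k : ℝ) + 1)))) ^ 2 := by
      intro k
      rw [real_inner_smul_left, mul_pow, Real.sin_sq_eq_half_sub, ← hy]
      have : 2 * (y / 2 * (1 / ((k : ℝ) + 1))) = 1 / ((k : ℝ) + 1) * y := by ring
      rw [this]; ring
    simp only [e]
    refine Tendsto.pow ?_ 2
    have hd : HasDerivAt (fun s : ℝ => 2 * Real.sin (y / 2 * s)) (2 * (Real.cos (y / 2 * 0) * (y / 2 * 1))) 0 :=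
      (((hasDerivAt_id (0 : ℝ)).const_mul (y / 2)).sin).const_mul 2
    have hs := hd.tendsto_slope_zero_right
    have hseq : Tendsto (fun k : ℕ => (1 : ℝ) / ((k : ℝ) + 1)) atTop (𝓝[>] 0) :=
      tendsto_nhdsWithin_iff.2 ⟨tendsto_one_div_add_atTop_nhds_zero_nat,
        .of_forall fun k => by simp only [mem_Ioi]; positivity⟩
    have h := hs.comp hseq
    refine (h.congr fun k => ?_).trans (by simp [mul_div_cancel₀])
    simp only [Function.comp_def]
    simp
    ring
  have hnn : ∀ g : Grp n m, 0 ≤ ⟪u, g.2⟫ ^ 2 * heatKernel 1 g := fun g => mul_nonneg (sq_nonneg _) (hk0 g)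
  have hmeas : AEStronglyMeasurable (fun g : Grp n m => ⟪u, g.2⟫ ^ 2 * heatKernel 1 g) :=
    Continuous.aestronglyMeasurable (by fun_prop)
  -- Fatou's lemma gives integrability and the upper bound together; equality is not needed.
  have hfat : ∫⁻ g : Grp n m, ENNReal.ofReal (⟪u, g.2⟫ ^ 2 * heatKernel 1 g) ≤ ENNReal.ofReal n := by
    calc ∫⁻ g : Grp n m, ENNReal.ofReal (⟪u, g.2⟫ ^ 2 * heatKernel 1 g)
        = ∫⁻ g : Grp n m, liminf (fun k => ENNReal.ofReal (F k g)) atTop := by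
          refine lintegral_congr fun g => ?_
          exact ((ENNReal.continuous_ofReal.tendsto _).comp (hlim g)).liminf_eq.symm
      _ ≤ liminf (fun k => ∫⁻ g, ENNReal.ofReal (F k g)) atTop := by
          refine lintegral_liminf_le' fun k => ?_
          exact (hFI k).aestronglyMeasurable.aemeasurable.ennreal_ofReal
      _ ≤ ENNReal.ofReal n := by
          refine liminf_le_of_le (by isBoundedDefault) fun b hb => ?_
          obtain ⟨k, hk⟩ := hb.exists
          refine hk.trans ?_
          rw [← ofReal_integral_eq_lintegral_ofReal (hFI k) (.of_forall (hF0 k))]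
          exact ENNReal.ofReal_le_ofReal (hFb k)
  refine ⟨⟨hmeas, ?_⟩, ?_⟩
  · rw [hasFiniteIntegral_iff_ofReal (.of_forall hnn)]
    exact hfat.trans_lt ENNReal.ofReal_lt_top
  · rw [integral_eq_lintegral_of_nonneg_ae (.of_forall hnn) hmeas]
    exact ENNReal.toReal_le_of_le_ofReal (Nat.cast_nonneg n) hfat

theorem heatKernel_neg_snd (hn : 0 < n) (hm : 0 < m) (x : Hor n) (z : Ver m) :
    heatKernel 1 (x, -z) = heatKernel 1 (x, z) := by
  simp only [heatKernel_one hn hm, inner_neg_right, Real.cos_neg]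

theorem integral_odd_snd_mul_heatKernel_one (hn : 0 < n) (hm : 0 < m) {F : Grp n m → ℝ}
    (hF : ∀ x z, F (x, -z) = -F (x, z)) : ∫ g, F g * heatKernel 1 g = 0 := by
  have hmp : MeasurePreserving (Prod.map id (fun z => -z) : Grp n m → Grp n m) :=
    (MeasurePreserving.id volume).prod (Measure.measurePreserving_neg volume)
  have hme : MeasurableEmbedding (Prod.map id (fun z => -z) : Grp n m → Grp n m) :=
    MeasurableEmbedding.id.prodMap (MeasurableEquiv.neg _).measurableEmbedding
  have h := hmp.integral_comp hme fun g => F g * heatKernel 1 g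
  have e : ∀ g : Grp n m, F (Prod.map id (fun z => -z) g) * heatKernel 1 (Prod.map id (fun z => -z) g) =
      -(F g * heatKernel 1 g) := fun g => by
    obtain ⟨x, z⟩ := g
    simp only [Prod.map_apply, id, hF, heatKernel_neg_snd hn hm x z, neg_mul]
  simp only [e, integral_neg] at h
  linarith

/-! ### Invariant vector fields and differentiation of `P_1` at the identity. -/

theorem bracket_swap (B : HTypeAlgebra n m) (x y : Hor n) : B.bracket x y = -B.bracket y x := by
  have h := B.bracket_self (x + y)
  simp only [map_add, LinearMap.add_apply, B.bracket_self, zero_add, add_zero] at h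
  exact eq_neg_of_add_eq_zero_right h

theorem single_eq_smul (i : Fin (2 * n)) (s : ℝ) :
    (EuclideanSpace.single i s : Hor n) = s • EuclideanSpace.single i (1 : ℝ) := by
  ext j; simp

/-- The tangent vector `X̂ᵢ(g)`. -/
def XHatVec (B : HTypeAlgebra n m) (i : Fin (2 * n)) (g : Grp n m) : Grp n m :=
  (EuclideanSpace.single i 1, (1 / 2 : ℝ) • B.bracket (EuclideanSpace.single i 1) g.1)

theorem hasDerivAt_mul_hvec (B : HTypeAlgebra n m) (i : Fin (2 * n)) (g : Grp n m) (s : ℝ) :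
    HasDerivAt (fun s => mul B g (hvec m i s)) (XVec B i g) s := by
  -- In these coordinates the translated horizontal line is affine.
  have h : (fun s => mul B g (hvec m i s)) = fun s => g + s • XVec B i g := by
    ext1 s
    refine Prod.ext ?_ ?_
    · simp [mul, hvec, XVec, ← single_eq_smul]
    · simp only [mul, hvec, XVec, single_eq_smul i s, Prod.snd_add, Prod.smul_snd, map_smul,
        add_zero, smul_smul]
      rw [mul_comm]
  rw [h]
  simpa using ((hasDerivAt_id s).smul_const (XVec B i g)).const_add g

theorem hasDerivAt_hvec_mul (B : HTypeAlgebra n m) (i : Fin (2 * n)) (g : Grp n m) (s : ℝ) :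
    HasDerivAt (fun s => mul B (hvec m i s) g) (XHatVec B i g) s := by
  have h : (fun s => mul B (hvec m i s) g) = fun s => g + s • XHatVec B i g := by
    ext1 s
    refine Prod.ext ?_ ?_
    · simp [mul, hvec, XHatVec, ← single_eq_smul, add_comm]
    · simp only [mul, hvec, XHatVec, single_eq_smul i s, Prod.snd_add, Prod.smul_snd, map_smul,
        LinearMap.smul_apply, zero_add, smul_smul]
      rw [mul_comm]
  rw [h]
  simpa using ((hasDerivAt_id s).smul_const (XHatVec B i g)).const_add g

theorem hvec_zero (i : Fin (2 * n)) : hvec m i 0 = 0 := by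
  refine Prod.ext ?_ rfl
  ext j; simp [hvec]

theorem zero_mul' (B : HTypeAlgebra n m) (g : Grp n m) : mul B 0 g = g := by
  simp [mul]

theorem mul_zero' (B : HTypeAlgebra n m) (g : Grp n m) : mul B g 0 = g := by
  simp [mul]

/-- Since `[e_i, e_i] = 0`, the right-invariant field is constant along its own flow line; this
gives derivatives under the integral at every `s`, not only at `0`. -/
theorem XHatVec_hvec_mul (B : HTypeAlgebra n m) (i : Fin (2 * n)) (s : ℝ) (g : Grp n m) :
    XHatVec B i (mul B (hvec m i s) g) = XHatVec B i g := by
  simp only [XHatVec, mul, hvec, single_eq_smul i s, map_add, map_smul, B.bracket_self, smul_zero,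
    zero_add]

section Calculus

variable {F G : Grp n m → ℝ}

theorem X_eq_fderiv (B : HTypeAlgebra n m) (i : Fin (2 * n)) {g : Grp n m}
    (hF : DifferentiableAt ℝ F g) : X B i F g = fderiv ℝ F g (XVec B i g) := by
  have h := hasDerivAt_mul_hvec B i g 0
  have hF' : HasFDerivAt F (fderiv ℝ F g) (mul B g (hvec m i 0)) := by
    rw [hvec_zero, mul_zero']; exact hF.hasFDerivAt
  exact (hF'.comp_hasDerivAt 0 h).deriv

theorem hasDerivAt_comp_hvec_mul (B : HTypeAlgebra n m) (i : Fin (2 * n))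
    (hF : Differentiable ℝ F) (g : Grp n m) (s : ℝ) :
    HasDerivAt (fun s => F (mul B (hvec m i s) g))
      (fderiv ℝ F (mul B (hvec m i s) g) (XHatVec B i (mul B (hvec m i s) g))) s := by
  rw [XHatVec_hvec_mul]
  exact (hF _).hasFDerivAt.comp_hasDerivAt s (hasDerivAt_hvec_mul B i g s)

theorem XHat_eq_fderiv (B : HTypeAlgebra n m) (i : Fin (2 * n)) (hF : Differentiable ℝ F)
    (g : Grp n m) : XHat B i F g = fderiv ℝ F g (XHatVec B i g) := by
  have h := (hasDerivAt_comp_hvec_mul B i hF g 0).deriv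
  rwa [hvec_zero, zero_mul'] at h

theorem X_mul (B : HTypeAlgebra n m) (i : Fin (2 * n)) (hF : Differentiable ℝ F)
    (hG : Differentiable ℝ G) (g : Grp n m) :
    X B i (fun k => F k * G k) g = G g * X B i F g + F g * X B i G g := by
  rw [X_eq_fderiv B i ((hF g).fun_mul (hG g)), X_eq_fderiv B i (hF g), X_eq_fderiv B i (hG g),
    fderiv_fun_mul (hF g) (hG g)]
  simp [add_comm]

theorem XHat_mul (B : HTypeAlgebra n m) (i : Fin (2 * n)) (hF : Differentiable ℝ F)
    (hG : Differentiable ℝ G) (g : Grp n m) :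
    XHat B i (fun k => F k * G k) g = G g * XHat B i F g + F g * XHat B i G g := by
  rw [XHat_eq_fderiv B i (hF.fun_mul hG), XHat_eq_fderiv B i hF, XHat_eq_fderiv B i hG,
    fderiv_fun_mul (hF g) (hG g)]
  simp [add_comm]

theorem grad_mul (B : HTypeAlgebra n m) (hF : Differentiable ℝ F)
    (hG : Differentiable ℝ G) (g : Grp n m) :
    grad B (fun k => F k * G k) g = G g • grad B F g + F g • grad B G g := by
  ext i
  exact X_mul B i hF hG g

theorem continuous_bracket (B : HTypeAlgebra n m) :
    Continuous fun p : Hor n × Hor n => B.bracket p.1 p.2 := by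
  have h : (fun p : Hor n × Hor n => B.bracket p.1 p.2) = fun p =>
      (LinearMap.toContinuousLinearMap
        ((LinearMap.toContinuousLinearMap : (Hor n →ₗ[ℝ] Ver m) ≃ₗ[ℝ] _).toLinearMap ∘ₗ B.bracket))
        p.1 p.2 := rfl
  rw [h]
  fun_prop

theorem continuous_XVec (B : HTypeAlgebra n m) (i : Fin (2 * n)) : Continuous (XVec B i) := by
  have h := continuous_bracket B
  have h2 : Continuous fun g : Grp n m => B.bracket g.1 (EuclideanSpace.single i 1) :=
    h.comp (continuous_fst.prodMk continuous_const)
  unfold XVec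
  fun_prop

theorem continuous_XHatVec (B : HTypeAlgebra n m) (i : Fin (2 * n)) : Continuous (XHatVec B i) := by
  have h := continuous_bracket B
  have h2 : Continuous fun g : Grp n m => B.bracket (EuclideanSpace.single i 1) g.1 :=
    h.comp (continuous_const.prodMk continuous_fst)
  unfold XHatVec
  fun_prop

theorem continuous_X (B : HTypeAlgebra n m) (i : Fin (2 * n)) (hF : ContDiff ℝ 1 F) :
    Continuous (X B i F) := by
  have h : X B i F = fun g => fderiv ℝ F g (XVec B i g) :=
    funext fun g => X_eq_fderiv B i (hF.differentiable one_ne_zero g)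
  rw [h]
  exact (hF.continuous_fderiv one_ne_zero).clm_apply (continuous_XVec B i)

theorem continuous_XHat (B : HTypeAlgebra n m) (i : Fin (2 * n)) (hF : ContDiff ℝ 1 F) :
    Continuous (XHat B i F) := by
  have h : XHat B i F = fun g => fderiv ℝ F g (XHatVec B i g) :=
    funext fun g => XHat_eq_fderiv B i (hF.differentiable one_ne_zero) g
  rw [h]
  exact (hF.continuous_fderiv one_ne_zero).clm_apply (continuous_XHatVec B i)

theorem continuous_grad (B : HTypeAlgebra n m) (hF : ContDiff ℝ 1 F) : Continuous (grad B F) := by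
  have := fun i => continuous_X B i hF
  unfold grad
  fun_prop

theorem continuous_gradHat (B : HTypeAlgebra n m) (hF : ContDiff ℝ 1 F) :
    Continuous (gradHat B F) := by
  have := fun i => continuous_XHat B i hF
  unfold gradHat
  fun_prop

theorem exists_bound_grad (B : HTypeAlgebra n m) (hF : ContDiff ℝ 1 F) (hs : HasCompactSupport F) :
    ∃ C, 0 ≤ C ∧ ∀ g, |F g| ≤ C ∧ ‖grad B F g‖ ≤ C ∧ ‖gradHat B F g‖ ≤ C := by
  have hd := hF.differentiable one_ne_zero
  have hs' := hs.fderiv ℝ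
  obtain ⟨C₁, h₁⟩ := hF.continuous.bounded_above_of_compact_support hs
  obtain ⟨C₂, h₂⟩ := (continuous_grad B hF).bounded_above_of_compact_support (hs'.mono (by
    intro g hg h0
    refine hg ?_
    ext i
    simp [grad, X_eq_fderiv B i (hd g), h0]))
  obtain ⟨C₃, h₃⟩ := (continuous_gradHat B hF).bounded_above_of_compact_support (hs'.mono (by
    intro g hg h0
    refine hg ?_
    ext i
    simp [gradHat, XHat_eq_fderiv B i hd, h0]))
  exact ⟨max C₁ (max C₂ C₃), (norm_nonneg _).trans ((h₁ 0).trans (le_max_left _ _)), fun g =>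
    ⟨(h₁ g).trans (le_max_left _ _), (h₂ g).trans ((le_max_left _ _).trans (le_max_right _ _)),
      (h₃ g).trans ((le_max_right _ _).trans (le_max_right _ _))⟩⟩

/-- Boundedness permits the growth rate `0`, so no estimate of `ccDist` enters. -/
theorem mem_ClassC_of_hasCompactSupport (B : HTypeAlgebra n m) (hF : ContDiff ℝ 1 F)
    (hs : HasCompactSupport F) : F ∈ ClassC B := by
  obtain ⟨C, hC, h⟩ := exists_bound_grad B hF hs
  refine ⟨hF, 3 * C, 0, 1 / 2, by positivity, le_rfl, by norm_num, by norm_num, fun g => ?_⟩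
  obtain ⟨h1, h2, h3⟩ := h g
  rw [zero_mul, Real.exp_zero]
  linarith

theorem heat_one_zero (B : HTypeAlgebra n m) (F : Grp n m → ℝ) :
    heat B 1 F 0 = ∫ k, F k * heatKernel 1 k := by
  unfold heat
  simp only [one_ne_zero, if_false, zero_mul']

/-- Left-invariant derivatives of `P_1 F` at the identity are right-invariant derivatives of `F`
under the integral. -/
theorem X_heat_one_zero (B : HTypeAlgebra n m) (hn : 0 < n) (hm : 0 < m) (hF : ContDiff ℝ 1 F)
    (hs : HasCompactSupport F) (i : Fin (2 * n)) :
    X B i (heat B 1 F) 0 = ∫ k, XHat B i F k * heatKernel 1 k := by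
  obtain ⟨C, hC, hb⟩ := exists_bound_grad B hF hs
  have hd := hF.differentiable one_ne_zero
  have hk := continuous_heatKernel_one (n := n) (m := m) hn hm
  have hk0 := heatKernel_one_nonneg (n := n) (m := m) hn hm
  have hkI := integrable_heatKernel_one (n := n) (m := m) hn hm
  have hFc := hF.continuous
  have hXc := continuous_XHat B i hF
  have hmul : ∀ s : ℝ, Continuous fun k : Grp n m => mul B (hvec m i s) k := fun s => by
    have h2 : Continuous fun g : Grp n m => B.bracket (hvec m i s).1 g.1 :=
      (continuous_bracket B).comp (continuous_const.prodMk continuous_fst)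
    unfold mul
    fun_prop
  have hX : ∀ k, |XHat B i F k| ≤ C := fun k =>
    (PiLp.norm_apply_le (gradHat B F k) i).trans (hb k).2.2
  -- At the identity, moving the base point by `(s e_i, 0)` multiplies the argument of `F` on the
  -- left, so differentiation in `s` gives the right-invariant field.
  have h := (hasDerivAt_integral_of_dominated_loc_of_deriv_le (μ := (volume : Measure (Grp n m)))
    (F := fun s k => F (mul B (hvec m i s) k) * heatKernel 1 k)
    (F' := fun s k => XHat B i F (mul B (hvec m i s) k) * heatKernel 1 k)
    (x₀ := (0 : ℝ)) (s := univ) (bound := fun k => C * heatKernel 1 k) univ_mem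
    (.of_forall fun s => ((hFc.comp (hmul s)).mul hk).aestronglyMeasurable)
    (hkI.bdd_mul (c := C) (hFc.comp (hmul 0)).aestronglyMeasurable (.of_forall fun k => (hb _).1))
    ((hXc.comp (hmul 0)).mul hk).aestronglyMeasurable
    (.of_forall fun k s _ => ?_) (hkI.const_mul C) (.of_forall fun k s _ => ?_)).2
  · simp only [hvec_zero, zero_mul'] at h
    rw [← h.deriv]
    unfold X heat
    simp only [one_ne_zero, if_false, zero_mul']
  · rw [norm_mul, Real.norm_of_nonneg (hk0 k)]
    exact mul_le_mul_of_nonneg_right (hX _) (hk0 k)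
  · refine HasDerivAt.mul_const ?_ _
    rw [XHat_eq_fderiv B i hd]
    exact hasDerivAt_comp_hvec_mul B i hd k s

end Calculus

section Moments

/-- Polynomial growth of the degree integrated below. -/
theorem integrable_mul_heatKernel_of_le (hn : 0 < n) (hm : 0 < m) {u : Ver m} (hu : ‖u‖ = 1)
    {F : Grp n m → ℝ} (hF : Continuous F) {C : ℝ}
    (h : ∀ g, |F g| ≤ C * (1 + ‖g.1‖ ^ 4 + ⟪u, g.2⟫ ^ 2)) :
    Integrable fun g => F g * heatKernel 1 g := by
  have hk := continuous_heatKernel_one (n := n) (m := m) hn hm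
  have hk0 := heatKernel_one_nonneg (n := n) (m := m) hn hm
  have h4 := integrable_fst_mul_heatKernel (m := m) hn hm (h := fun x => ‖x‖ ^ 4) (by fun_prop)
    (integrable_norm_pow_mul_gaussWeight (n := n) 2)
  have hW := (((integrable_heatKernel_one (n := n) (m := m) hn hm).add h4).add
    (integral_inner_snd_sq_mul_heatKernel_one (n := n) hn hm hu).1).const_mul C
  refine hW.mono' (hF.mul hk).aestronglyMeasurable (.of_forall fun g => ?_)
  rw [norm_mul, Real.norm_of_nonneg (hk0 g)]
  refine (mul_le_mul_of_nonneg_right (h g) (hk0 g)).trans_eq ?_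
  simp only [Pi.add_apply]
  ring

end Moments

/-! ### The test function, its gradients and their expectations. -/

/-- The extremal function `a ⟨x, eᵢ⟩ + ⟨u, z⟩ ⟨x, J_u eᵢ⟩`. -/
def witness (B : HTypeAlgebra n m) (u : Ver m) (i : Fin (2 * n)) (a : ℝ)
    (g : Grp n m) : ℝ :=
  a * g.1 i + ⟪u, g.2⟫ * ⟪g.1, J B.bracket u (EuclideanSpace.single i 1)⟫

section Witness

variable (B : HTypeAlgebra n m) {u : Ver m} (hu : ‖u‖ = 1) (i : Fin (2 * n)) (a : ℝ)

theorem contDiff_witness : ContDiff ℝ 1 (witness B u i a) := by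
  unfold witness
  have h : ContDiff ℝ 1 fun g : Grp n m => g.1 i :=
    (EuclideanSpace.proj (𝕜 := ℝ) i : Hor n →L[ℝ] ℝ).contDiff.comp contDiff_fst
  have h2 : ContDiff ℝ 1 fun g : Grp n m => ⟪u, g.2⟫ := contDiff_const.inner ℝ contDiff_snd
  have h3 : ContDiff ℝ 1 fun g : Grp n m => ⟪g.1, J B.bracket u (EuclideanSpace.single i 1)⟫ :=
    contDiff_fst.inner ℝ contDiff_const
  exact (contDiff_const.mul h).add (h2.mul h3)

theorem fderiv_witness (g w : Grp n m) : fderiv ℝ (witness B u i a) g w =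
    a * w.1 i + (⟪u, w.2⟫ * ⟪g.1, J B.bracket u (EuclideanSpace.single i 1)⟫ +
      ⟪u, g.2⟫ * ⟪w.1, J B.bracket u (EuclideanSpace.single i 1)⟫) := by
  set v := J B.bracket u (EuclideanSpace.single i 1) with hv
  have hline : HasDerivAt (fun s : ℝ => g + s • w) w 0 := by
    simpa using ((hasDerivAt_id (0 : ℝ)).smul_const w).const_add g
  have hd : HasFDerivAt (witness B u i a) (fderiv ℝ (witness B u i a) g) (g + (0 : ℝ) • w) := by
    rw [zero_smul, add_zero]
    exact ((contDiff_witness B i a).differentiable one_ne_zero g).hasFDerivAt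
  have h1 := hd.comp_hasDerivAt 0 hline
  have e : (witness B u i a ∘ fun s : ℝ => g + s • w) = fun s => a * (g.1 i + s * w.1 i) +
      (⟪u, g.2⟫ + s * ⟪u, w.2⟫) * (⟪g.1, v⟫ + s * ⟪w.1, v⟫) := by
    ext s
    simp only [Function.comp_apply, witness, ← hv, Prod.fst_add, Prod.snd_add, Prod.smul_fst,
      Prod.smul_snd, inner_add_left, inner_add_right, real_inner_smul_left, real_inner_smul_right,
      PiLp.add_apply, PiLp.smul_apply, smul_eq_mul]
  rw [e] at h1
  have hlin : ∀ b c : ℝ, HasDerivAt (fun s : ℝ => b + s * c) c 0 := fun b c => by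
    simpa using ((hasDerivAt_id (0 : ℝ)).mul_const c).const_add b
  have h2 := ((hlin (g.1 i) (w.1 i)).const_mul a).add
    ((hlin ⟪u, g.2⟫ ⟪u, w.2⟫).mul (hlin ⟪g.1, v⟫ ⟪w.1, v⟫))
  have := h1.unique h2
  simpa using this

theorem inner_J_single_self : ⟪(EuclideanSpace.single i (1 : ℝ) : Hor n),
    J B.bracket u (EuclideanSpace.single i 1)⟫ = 0 := by
  rw [real_inner_comm, inner_J, B.bracket_self, inner_zero_right]

theorem grad_witness (g : Grp n m) : grad B (witness B u i a) g =
    a • EuclideanSpace.single i 1 +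
      (1 / 2 * ⟪g.1, J B.bracket u (EuclideanSpace.single i 1)⟫) • J B.bracket u g.1 +
      ⟪u, g.2⟫ • J B.bracket u (EuclideanSpace.single i 1) := by
  set v := J B.bracket u (EuclideanSpace.single i 1) with hv
  ext j
  have h1 : ⟪u, B.bracket g.1 (EuclideanSpace.single j 1)⟫ = J B.bracket u g.1 j := by
    rw [← inner_J]; simp [EuclideanSpace.inner_single_right]
  have h2 : ⟪(EuclideanSpace.single j (1 : ℝ) : Hor n), v⟫ = v j := by
    simp [EuclideanSpace.inner_single_left]
  simp only [grad, X_eq_fderiv B j ((contDiff_witness B i a).differentiable one_ne_zero g),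
    fderiv_witness, ← hv, XVec, real_inner_smul_right, h1, h2, PiLp.add_apply, PiLp.smul_apply,
    smul_eq_mul, PiLp.single_apply, eq_comm (a := i)]
  ring

theorem X_witness (g : Grp n m) : X B i (witness B u i a) g =
    a - 1 / 2 * ⟪g.1, J B.bracket u (EuclideanSpace.single i 1)⟫ ^ 2 := by
  have h1 : ⟪u, B.bracket g.1 (EuclideanSpace.single i 1)⟫ =
      -⟪g.1, J B.bracket u (EuclideanSpace.single i 1)⟫ := by
    rw [bracket_swap, inner_neg_right, ← inner_J, real_inner_comm]
  rw [X_eq_fderiv B i ((contDiff_witness B i a).differentiable one_ne_zero g), fderiv_witness]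
  simp only [XVec, real_inner_smul_right, h1, inner_J_single_self, PiLp.single_apply, if_true]
  ring

/-- The central component of the right-invariant field has the opposite sign, so the quadratic term
is reversed compared with `X_witness`. This sign is the source of the strict inequality. -/
theorem XHat_witness (g : Grp n m) : XHat B i (witness B u i a) g =
    a + 1 / 2 * ⟪g.1, J B.bracket u (EuclideanSpace.single i 1)⟫ ^ 2 := by
  have h1 : ⟪u, B.bracket (EuclideanSpace.single i 1) g.1⟫ =
      ⟪g.1, J B.bracket u (EuclideanSpace.single i 1)⟫ := by
    rw [← inner_J, real_inner_comm]
  rw [XHat_eq_fderiv B i ((contDiff_witness B i a).differentiable one_ne_zero), fderiv_witness]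
  simp only [XHatVec, real_inner_smul_right, h1, inner_J_single_self, PiLp.single_apply, if_true]
  ring

include hu in
-- With `v = J_u e_i`, expand the three-term gradient using `|J_u x| = |x|`, `e_i ⟂ v` and `⟨J_u x,
-- e_i⟩ = -⟨x, v⟩`. The final summand is odd in `z` and will integrate to zero.
theorem norm_grad_witness_sq (g : Grp n m) : ‖grad B (witness B u i a) g‖ ^ 2 =
    a ^ 2 + ⟪u, g.2⟫ ^ 2 +
      1 / 4 * (⟪g.1, J B.bracket u (EuclideanSpace.single i 1)⟫ ^ 2 * ‖g.1‖ ^ 2) -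
      a * ⟪g.1, J B.bracket u (EuclideanSpace.single i 1)⟫ ^ 2 +
      ⟪u, g.2⟫ * (⟪g.1, J B.bracket u (EuclideanSpace.single i 1)⟫ *
        ⟪u, B.bracket g.1 (J B.bracket u (EuclideanSpace.single i 1))⟫) := by
  rw [grad_witness]
  have hv1 := B.orthogonal_J u hu (EuclideanSpace.single i 1)
  have hw1 := B.orthogonal_J u hu g.1
  have hev := inner_J_single_self B (u := u) i
  have hew : ⟪J B.bracket u g.1, (EuclideanSpace.single i (1 : ℝ) : Hor n)⟫ =
      -⟪g.1, J B.bracket u (EuclideanSpace.single i 1)⟫ := by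
    rw [inner_J, bracket_swap, inner_neg_right, ← inner_J, real_inner_comm]
  have hwv := inner_J B.bracket u g.1 (J B.bracket u (EuclideanSpace.single i 1))
  set v := J B.bracket u (EuclideanSpace.single i 1)
  set w := J B.bracket u g.1
  set e : Hor n := EuclideanSpace.single i 1 with he
  have he1 : ‖e‖ = 1 := by simp [he]
  rw [he1] at hv1
  rw [← hwv, norm_add_sq_real, norm_add_sq_real, inner_add_left]
  simp only [norm_smul, real_inner_smul_left, real_inner_smul_right, mul_pow, hv1, hw1, he1, hev,
    Real.norm_eq_abs, sq_abs]
  rw [real_inner_comm w e, hew]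
  ring

end Witness

section Expectations

variable (B : HTypeAlgebra n m) (hn : 0 < n) (hm : 0 < m) {u : Ver m} (hu : ‖u‖ = 1)
  (i : Fin (2 * n)) (a : ℝ)

include hu in
theorem norm_J_single : ‖J B.bracket u (EuclideanSpace.single i 1)‖ = 1 := by
  rw [B.orthogonal_J u hu]; simp

include hn hm hu in
theorem integral_inner_sq_mul_heatKernel_one :
    Integrable (fun g : Grp n m =>
      ⟪g.1, J B.bracket u (EuclideanSpace.single i 1)⟫ ^ 2 * heatKernel 1 g) ∧
    ∫ g : Grp n m, ⟪g.1, J B.bracket u (EuclideanSpace.single i 1)⟫ ^ 2 * heatKernel 1 g = 2 := by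
  have hv := norm_J_single B hu i
  set v := J B.bracket u (EuclideanSpace.single i 1)
  have hI : Integrable fun x : Hor n => ⟪x, v⟫ ^ 2 * gaussWeight n x := by
    simpa using integrable_inner_sq_norm_pow_mul_gaussWeight v 0
  have hc : Continuous fun x : Hor n => ⟪x, v⟫ ^ 2 := by fun_prop
  refine ⟨integrable_fst_mul_heatKernel hn hm hc hI, ?_⟩
  rw [integral_fst_mul_heatKernel hn hm hc hI, integral_inner_sq_mul_gaussWeight hn hv]

include hn hm hu in
theorem integral_X_witness :
    Integrable (fun g => X B i (witness B u i a) g * heatKernel 1 g) ∧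
      ∫ g, X B i (witness B u i a) g * heatKernel 1 g = a - 1 := by
  obtain ⟨hI, h⟩ := integral_inner_sq_mul_heatKernel_one B hn hm hu i
  have hk := integrable_heatKernel_one (n := n) (m := m) hn hm
  have e : (fun g => X B i (witness B u i a) g * heatKernel 1 g) = fun g => a * heatKernel 1 g -
      1 / 2 * (⟪g.1, J B.bracket u (EuclideanSpace.single i 1)⟫ ^ 2 * heatKernel 1 g) := by
    ext g; rw [X_witness]; ring
  rw [e]
  refine ⟨(hk.const_mul a).sub (hI.const_mul _), ?_⟩
  rw [integral_sub (hk.const_mul a) (hI.const_mul _), integral_const_mul, integral_const_mul, h,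
    integral_heatKernel_one hn hm]
  ring

include hn hm hu in
theorem integral_XHat_witness :
    Integrable (fun g => XHat B i (witness B u i a) g * heatKernel 1 g) ∧
      ∫ g, XHat B i (witness B u i a) g * heatKernel 1 g = a + 1 := by
  obtain ⟨hI, h⟩ := integral_inner_sq_mul_heatKernel_one B hn hm hu i
  have hk := integrable_heatKernel_one (n := n) (m := m) hn hm
  have e : (fun g => XHat B i (witness B u i a) g * heatKernel 1 g) = fun g => a * heatKernel 1 g +
      1 / 2 * (⟪g.1, J B.bracket u (EuclideanSpace.single i 1)⟫ ^ 2 * heatKernel 1 g) := by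
    ext g; rw [XHat_witness]; ring
  rw [e]
  refine ⟨(hk.const_mul a).add (hI.const_mul _), ?_⟩
  rw [integral_add (hk.const_mul a) (hI.const_mul _), integral_const_mul, integral_const_mul, h,
    integral_heatKernel_one hn hm]
  ring

include hn hm hu in
-- Term by term the expectations are `a²`, at most `n`, `¼ · 8(n+1)`, `-2a` and `0`. The only
-- inequality comes from the central second moment.
theorem integral_norm_grad_witness_sq :
    Integrable (fun g => ‖grad B (witness B u i a) g‖ ^ 2 * heatKernel 1 g) ∧
      ∫ g, ‖grad B (witness B u i a) g‖ ^ 2 * heatKernel 1 g ≤ a ^ 2 - 2 * a + 3 * n + 2 := by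
  obtain ⟨hI2, h2⟩ := integral_inner_sq_mul_heatKernel_one B hn hm hu i
  obtain ⟨hIz, hz⟩ := integral_inner_snd_sq_mul_heatKernel_one (n := n) hn hm hu
  have hk := integrable_heatKernel_one (n := n) (m := m) hn hm
  have hv := norm_J_single B hu i
  have hq : ∀ x, |⟪u, B.bracket x (J B.bracket u (EuclideanSpace.single i 1))⟫| ≤ ‖x‖ := fun x => by
    rw [← inner_J]
    refine (abs_real_inner_le_norm _ _).trans_eq ?_
    rw [hv, B.orthogonal_J u hu, mul_one]
  have hq' := continuous_bracket B
  have hp : ∀ x, |⟪x, J B.bracket u (EuclideanSpace.single i 1)⟫| ≤ ‖x‖ := fun x => by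
    refine (abs_real_inner_le_norm _ _).trans_eq ?_
    rw [hv, mul_one]
  have hsq := norm_grad_witness_sq B hu i a
  set v := J B.bracket u (EuclideanSpace.single i 1)
  have hqc : Continuous fun g : Grp n m => B.bracket g.1 v :=
    hq'.comp (continuous_fst.prodMk continuous_const)
  have hI4' : Integrable fun x : Hor n => ⟪x, v⟫ ^ 2 * ‖x‖ ^ 2 * gaussWeight n x := by
    simpa [mul_assoc] using integrable_inner_sq_norm_pow_mul_gaussWeight v 1
  have hI4 := integrable_fst_mul_heatKernel (m := m) hn hm (by fun_prop) hI4'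
  have h4 := integral_fst_mul_heatKernel (m := m) hn hm (by fun_prop) hI4'
  rw [integral_inner_sq_norm_sq_mul_gaussWeight hn hv] at h4
  have hIo : Integrable fun g : Grp n m => ⟪u, g.2⟫ * (⟪g.1, v⟫ * ⟪u, B.bracket g.1 v⟫) *
      heatKernel 1 g := by
    refine integrable_mul_heatKernel_of_le hn hm hu (by fun_prop) (C := 1) fun g => ?_
    rw [abs_mul, abs_mul]
    have h1 : |⟪g.1, v⟫| * |⟪u, B.bracket g.1 v⟫| ≤ ‖g.1‖ * ‖g.1‖ := by
      gcongr
      · exact hp _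
      · exact hq _
    have h3 : |⟪u, g.2⟫| * (|⟪g.1, v⟫| * |⟪u, B.bracket g.1 v⟫|) ≤ |⟪u, g.2⟫| * ‖g.1‖ ^ 2 := by
      rw [pow_two]; gcongr
    have h5 := sq_abs ⟪u, g.2⟫
    nlinarith [sq_nonneg (|⟪u, g.2⟫| - ‖g.1‖ ^ 2), sq_nonneg (|⟪u, g.2⟫|)]
  have ho : ∫ g : Grp n m, ⟪u, g.2⟫ * (⟪g.1, v⟫ * ⟪u, B.bracket g.1 v⟫) * heatKernel 1 g = 0 :=
    integral_odd_snd_mul_heatKernel_one hn hm (F := fun g => ⟪u, g.2⟫ * (⟪g.1, v⟫ * ⟪u, B.bracket g.1 v⟫))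
      fun x z => by simp only [inner_neg_right, neg_mul]
  have e : (fun g => ‖grad B (witness B u i a) g‖ ^ 2 * heatKernel 1 g) = fun g =>
      a ^ 2 * heatKernel 1 g + ⟪u, g.2⟫ ^ 2 * heatKernel 1 g +
      1 / 4 * (⟪g.1, v⟫ ^ 2 * ‖g.1‖ ^ 2 * heatKernel 1 g) - a * (⟪g.1, v⟫ ^ 2 * heatKernel 1 g) +
      ⟪u, g.2⟫ * (⟪g.1, v⟫ * ⟪u, B.bracket g.1 v⟫) * heatKernel 1 g := by
    ext g; rw [hsq]; ring
  rw [e]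
  have i1 := (hk.const_mul (a ^ 2)).add hIz
  have i2 := i1.add (hI4.const_mul (1 / 4))
  have i3 := i2.sub (hI2.const_mul a)
  refine ⟨i3.add hIo, ?_⟩
  have e1 := integral_add i3 hIo
  have e2 := integral_sub i2 (hI2.const_mul a)
  have e3 := integral_add i1 (hI4.const_mul (1 / 4))
  have e4 := integral_add (hk.const_mul (a ^ 2)) hIz
  rw [integral_const_mul, integral_heatKernel_one hn hm] at e4
  rw [integral_const_mul, h4] at e3
  rw [integral_const_mul, h2] at e2
  rw [ho] at e1
  simp only [Pi.add_apply, Pi.sub_apply] at e1 e2 e3 e4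
  rw [e1, e2, e3, e4]
  linarith

include hn hm hu in
theorem integrable_norm_grad_witness :
    Integrable fun g => ‖grad B (witness B u i a) g‖ * heatKernel 1 g := by
  have hk := integrable_heatKernel_one (n := n) (m := m) hn hm
  have hk0 := heatKernel_one_nonneg (n := n) (m := m) hn hm
  have hc := continuous_grad B (contDiff_witness B (u := u) i a)
  refine (hk.add (integral_norm_grad_witness_sq B hn hm hu i a).1).mono'
    (hc.norm.mul (continuous_heatKernel_one hn hm)).aestronglyMeasurable (.of_forall fun g => ?_)
  rw [norm_mul, norm_norm, Real.norm_of_nonneg (hk0 g)]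
  simp only [Pi.add_apply]
  nlinarith [hk0 g, sq_nonneg (‖grad B (witness B u i a) g‖ - 1), sq_nonneg ‖grad B (witness B u i a) g‖,
    mul_nonneg (hk0 g) (sq_nonneg (‖grad B (witness B u i a) g‖ - 1)),
    mul_nonneg (hk0 g) (sq_nonneg ‖grad B (witness B u i a) g‖)]

include hn hm hu in
theorem integrable_witness :
    Integrable fun g => |witness B u i a g| * heatKernel 1 g := by
  have hc := (contDiff_witness B (u := u) i a).continuous
  refine integrable_mul_heatKernel_of_le hn hm hu hc.abs (C := |a| + 1) fun g => ?_
  rw [abs_abs]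
  unfold witness
  have h1 : |g.1 i| ≤ ‖g.1‖ := PiLp.norm_apply_le g.1 i
  have h2 : |⟪g.1, J B.bracket u (EuclideanSpace.single i 1)⟫| ≤ ‖g.1‖ := by
    refine (abs_real_inner_le_norm _ _).trans_eq ?_
    rw [norm_J_single B hu i, mul_one]
  refine (abs_add_le _ _).trans ?_
  rw [abs_mul, abs_mul]
  have h3 := mul_le_mul_of_nonneg_left h1 (abs_nonneg a)
  have h4 := mul_le_mul_of_nonneg_left h2 (abs_nonneg ⟪u, g.2⟫)
  have h5 : ‖g.1‖ ≤ 1 + ‖g.1‖ ^ 4 := by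
    nlinarith [sq_nonneg (‖g.1‖ ^ 2 - 1), sq_nonneg (‖g.1‖ - 1), sq_nonneg (‖g.1‖ ^ 2)]
  have h6 : ‖g.1‖ ^ 2 ≤ 1 + ‖g.1‖ ^ 4 := by
    nlinarith [sq_nonneg (‖g.1‖ ^ 2 - 1), sq_nonneg (‖g.1‖ ^ 2)]
  have h7 : |⟪u, g.2⟫| * ‖g.1‖ ≤ 1 + ‖g.1‖ ^ 4 + ⟪u, g.2⟫ ^ 2 := by
    nlinarith [sq_nonneg (|⟪u, g.2⟫| - ‖g.1‖), sq_abs ⟪u, g.2⟫]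
  have h8 : |a| * ‖g.1‖ ≤ |a| * (1 + ‖g.1‖ ^ 4 + ⟪u, g.2⟫ ^ 2) := by
    gcongr
    nlinarith [sq_nonneg ⟪u, g.2⟫]
  linarith

end Expectations

/-! ### Truncation to compact support. -/

section Truncation

/-- The functions `f · (χ ∘ δ_s)` for `s = 1 / (k + 1)`. -/
def trunc (χ f : Grp n m → ℝ) (k : ℕ) (g : Grp n m) : ℝ :=
  f g * χ (dil (1 / ((k : ℝ) + 1)) g)

variable {χ f : Grp n m → ℝ}

theorem contDiff_trunc (hχ : ContDiff ℝ 1 χ) (hf : ContDiff ℝ 1 f) (k : ℕ) :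
    ContDiff ℝ 1 (trunc χ f k) :=
  hf.mul (hχ.comp (contDiff_dil _))

theorem hasCompactSupport_trunc (hs : HasCompactSupport χ) (k : ℕ) :
    HasCompactSupport (trunc χ f k) := by
  have hpos : (1 / ((k : ℝ) + 1)) ≠ 0 := by positivity
  let e : Grp n m ≃ₜ Grp n m :=
    { toFun := dil (1 / ((k : ℝ) + 1)), invFun := dil (1 / ((k : ℝ) + 1))⁻¹,
      left_inv := fun g => by
        have := dil_dil_inv (inv_ne_zero hpos) g
        rwa [inv_inv] at this
      right_inv := dil_dil_inv hpos, continuous_toFun := (contDiff_dil _).continuous,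
      continuous_invFun := (contDiff_dil _).continuous }
  exact (hs.comp_homeomorph e).mul_left

theorem tendsto_dil (g : Grp n m) :
    Tendsto (fun k : ℕ => dil (1 / ((k : ℝ) + 1)) g) atTop (𝓝 0) := by
  have hc : Continuous fun s : ℝ => dil s g := by unfold dil; fun_prop
  have h0 : dil 0 g = 0 := by simp [dil]
  have := (hc.tendsto 0).comp (tendsto_one_div_add_atTop_nhds_zero_nat (𝕜 := ℝ))
  rwa [h0] at this

/-- The product rule puts both the gradient and each right-invariant derivative of a truncation in
this form. Differentiating the dilated cutoff yields the factor `1 / (k + 1)`, which kills the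
second term. -/
theorem tendsto_trunc_aux {E : Type*} [NormedAddCommGroup E] [NormedSpace ℝ E]
    (hχ : Continuous χ) (h1 : χ 0 = 1) {C : ℝ} {D : Grp n m → E} (hD : ∀ g, ‖D g‖ ≤ C)
    (v : E) (g : Grp n m) :
    Tendsto (fun k : ℕ => χ (dil (1 / ((k : ℝ) + 1)) g) • v +
      f g • (1 / ((k : ℝ) + 1)) • D (dil (1 / ((k : ℝ) + 1)) g)) atTop (𝓝 v) := by
  have hlim : Tendsto (fun k : ℕ => χ (dil (1 / ((k : ℝ) + 1)) g)) atTop (𝓝 1) := by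
    have := (hχ.tendsto 0).comp (tendsto_dil g)
    rwa [h1] at this
  have h0 : Tendsto (fun k : ℕ => (1 / ((k : ℝ) + 1)) • D (dil (1 / ((k : ℝ) + 1)) g)) atTop (𝓝 0) := by
    refine squeeze_zero_norm (a := fun k : ℕ => 1 / ((k : ℝ) + 1) * C) (fun k => ?_) ?_
    · rw [norm_smul, Real.norm_of_nonneg (by positivity)]
      exact mul_le_mul_of_nonneg_left (hD _) (by positivity)
    · simpa using (tendsto_one_div_add_atTop_nhds_zero_nat (𝕜 := ℝ)).mul_const C
  simpa using (hlim.smul_const v).add (h0.const_smul (f g))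

theorem norm_trunc_aux_le {E : Type*} [NormedAddCommGroup E] [NormedSpace ℝ E]
    (hb : ∀ g, |χ g| ≤ 1) {C : ℝ} {D : Grp n m → E} (hD : ∀ g, ‖D g‖ ≤ C)
    (v : E) (g : Grp n m) (k : ℕ) :
    ‖χ (dil (1 / ((k : ℝ) + 1)) g) • v +
      f g • (1 / ((k : ℝ) + 1)) • D (dil (1 / ((k : ℝ) + 1)) g)‖ ≤ ‖v‖ + C * |f g| := by
  have hC : 0 ≤ C := (norm_nonneg _).trans (hD 0)
  have hk : 1 / ((k : ℝ) + 1) ≤ 1 := by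
    rw [div_le_one (by positivity)]; linarith [Nat.cast_nonneg (α := ℝ) k]
  refine (norm_add_le _ _).trans (add_le_add ?_ ?_)
  · rw [norm_smul]
    exact mul_le_of_le_one_left (norm_nonneg _) (hb _)
  · rw [norm_smul, norm_smul, Real.norm_of_nonneg (by positivity : 0 ≤ 1 / ((k : ℝ) + 1)), mul_comm,
      Real.norm_eq_abs]
    refine mul_le_mul_of_nonneg_right ?_ (abs_nonneg _)
    exact (mul_le_of_le_one_left (norm_nonneg _) hk).trans (hD _)

theorem grad_trunc (B : HTypeAlgebra n m) (hχ : ContDiff ℝ 1 χ) (hf : ContDiff ℝ 1 f) (k : ℕ)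
    (g : Grp n m) : grad B (trunc χ f k) g = χ (dil (1 / ((k : ℝ) + 1)) g) • grad B f g +
      f g • (1 / ((k : ℝ) + 1)) • grad B χ (dil (1 / ((k : ℝ) + 1)) g) := by
  rw [← grad_comp_dil]
  exact grad_mul B (hf.differentiable one_ne_zero)
    ((hχ.comp (contDiff_dil _)).differentiable one_ne_zero) g

theorem XHat_trunc (B : HTypeAlgebra n m) (hχ : ContDiff ℝ 1 χ) (hf : ContDiff ℝ 1 f) (k : ℕ)
    (i : Fin (2 * n)) (g : Grp n m) :
    XHat B i (trunc χ f k) g = χ (dil (1 / ((k : ℝ) + 1)) g) • XHat B i f g +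
      f g • (1 / ((k : ℝ) + 1)) • XHat B i χ (dil (1 / ((k : ℝ) + 1)) g) := by
  have h : XHat B i (fun g => χ (dil (1 / ((k : ℝ) + 1)) g)) g = _ :=
    congrArg (fun v : Hor n => v i) (gradHat_comp_dil B χ (1 / ((k : ℝ) + 1)) g)
  simp only [PiLp.smul_apply] at h
  have hG : Differentiable ℝ fun g => χ (dil (1 / ((k : ℝ) + 1)) g) :=
    (hχ.comp (contDiff_dil _)).differentiable one_ne_zero
  unfold trunc
  rw [XHat_mul B i (hf.differentiable one_ne_zero) hG, h]
  rfl

theorem exists_cutoff (n m : ℕ) : ∃ χ : Grp n m → ℝ, ContDiff ℝ 1 χ ∧ HasCompactSupport χ ∧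
    χ 0 = 1 ∧ ∀ g, |χ g| ≤ 1 := by
  let b : ContDiffBump (0 : Grp n m) := ⟨1, 2, one_pos, one_lt_two⟩
  refine ⟨b, b.contDiff, b.hasCompactSupport, b.one_of_mem_closedBall (by simp [b]), fun g => ?_⟩
  rw [abs_of_nonneg b.nonneg]
  exact b.le_one

variable (B : HTypeAlgebra n m) (hn : 0 < n) (hm : 0 < m)

include hn hm in
theorem tendsto_integral_norm_grad_trunc (hχ : ContDiff ℝ 1 χ) (hs : HasCompactSupport χ)
    (h1 : χ 0 = 1) (hb : ∀ g, |χ g| ≤ 1) (hf : ContDiff ℝ 1 f)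
    (hfI : Integrable fun g => |f g| * heatKernel 1 g)
    (hgI : Integrable fun g => ‖grad B f g‖ * heatKernel 1 g) :
    Tendsto (fun k => ∫ g, ‖grad B (trunc χ f k) g‖ * heatKernel 1 g) atTop
      (𝓝 (∫ g, ‖grad B f g‖ * heatKernel 1 g)) := by
  obtain ⟨C, hC, hCb⟩ := exists_bound_grad B hχ hs
  have hk0 := heatKernel_one_nonneg (n := n) (m := m) hn hm
  refine tendsto_integral_of_dominated_convergence
    (fun g => ‖grad B f g‖ * heatKernel 1 g + C * (|f g| * heatKernel 1 g)) (fun k =>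
    ((continuous_grad B (contDiff_trunc hχ hf k)).norm.mul
      (continuous_heatKernel_one hn hm)).aestronglyMeasurable)
    (hgI.add (hfI.const_mul C)) (fun k => .of_forall fun g => ?_) (.of_forall fun g => ?_)
  · rw [norm_mul, norm_norm, Real.norm_of_nonneg (hk0 g), grad_trunc B hχ hf]
    have := norm_trunc_aux_le (f := f) hb (fun g => (hCb g).2.1) (grad B f g) g k
    nlinarith [hk0 g]
  · simp only [grad_trunc B hχ hf]
    exact (tendsto_trunc_aux hχ.continuous h1 (fun g => (hCb g).2.1) _ g).norm.mul_const _

include hn hm in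
theorem tendsto_integral_XHat_trunc (hχ : ContDiff ℝ 1 χ) (hs : HasCompactSupport χ)
    (h1 : χ 0 = 1) (hb : ∀ g, |χ g| ≤ 1) (hf : ContDiff ℝ 1 f) (i : Fin (2 * n))
    (hfI : Integrable fun g => |f g| * heatKernel 1 g)
    (hgI : Integrable fun g => XHat B i f g * heatKernel 1 g) :
    Tendsto (fun k => ∫ g, XHat B i (trunc χ f k) g * heatKernel 1 g) atTop
      (𝓝 (∫ g, XHat B i f g * heatKernel 1 g)) := by
  obtain ⟨C, hC, hCb⟩ := exists_bound_grad B hχ hs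
  have hk0 := heatKernel_one_nonneg (n := n) (m := m) hn hm
  have hD : ∀ g, ‖XHat B i χ g‖ ≤ C := fun g =>
    (PiLp.norm_apply_le (gradHat B χ g) i).trans (hCb g).2.2
  refine tendsto_integral_of_dominated_convergence
    (fun g => ‖XHat B i f g * heatKernel 1 g‖ + C * (|f g| * heatKernel 1 g)) (fun k =>
    ((continuous_XHat B i (contDiff_trunc hχ hf k)).mul
      (continuous_heatKernel_one hn hm)).aestronglyMeasurable)
    (hgI.norm.add (hfI.const_mul C)) (fun k => .of_forall fun g => ?_) (.of_forall fun g => ?_)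
  · rw [norm_mul, norm_mul, Real.norm_of_nonneg (hk0 g), XHat_trunc B hχ hf]
    have := norm_trunc_aux_le (f := f) hb hD (XHat B i f g) g k
    nlinarith [hk0 g]
  · simp only [XHat_trunc B hχ hf]
    exact (tendsto_trunc_aux hχ.continuous h1 hD _ g).mul_const _

include hn hm in
/-- A function of class `C¹` whose gradients have suitable moments bounds `K_opt(1)` from below,
through its truncations. -/
theorem le_Kopt_one (hf : ContDiff ℝ 1 f) (i : Fin (2 * n))
    (hfI : Integrable fun g => |f g| * heatKernel 1 g)
    (hXI : Integrable fun g => XHat B i f g * heatKernel 1 g)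
    (hgI : Integrable fun g => ‖grad B f g‖ * heatKernel 1 g)
    (hpos : 0 < ∫ g, ‖grad B f g‖ * heatKernel 1 g) :
    (∃ F ∈ ClassC B, ∃ g, grad B F g ≠ 0) ∧
    (((∫ g, XHat B i f g * heatKernel 1 g) / ∫ g, ‖grad B f g‖ * heatKernel 1 g : ℝ) : EReal) ≤
      Kopt B 1 := by
  obtain ⟨χ, hχ, hs, h1, hb⟩ := exists_cutoff n m
  have hg := tendsto_integral_norm_grad_trunc B hn hm hχ hs h1 hb hf hfI hgI
  have hX := tendsto_integral_XHat_trunc B hn hm hχ hs h1 hb hf i hfI hXI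
  -- The denominators are eventually positive, so the truncations become admissible and at least one
  -- has a nonzero gradient.
  have hev := hg.eventually (lt_mem_nhds hpos)
  have hmem : ∀ k, trunc χ f k ∈ ClassC B := fun k =>
    mem_ClassC_of_hasCompactSupport B (contDiff_trunc hχ hf k) (hasCompactSupport_trunc hs k)
  constructor
  · obtain ⟨k, hk⟩ := hev.exists
    refine ⟨_, hmem k, ?_⟩
    by_contra! hcon
    simp [hcon] at hk
  · have hlim := (continuous_coe_real_ereal.tendsto _).comp (hX.div hg hpos.ne')
    refine le_of_tendsto hlim (hev.mono fun k hk => ?_)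
    have hval := heat_one_zero B (fun g => ‖grad B (trunc χ f k) g‖)
    refine le_trans ?_ (le_sSup ⟨trunc χ f k, hmem k, 0, by rw [hval]; exact hk.ne', rfl⟩)
    rw [Function.comp_apply, EReal.coe_le_coe_iff, hval]
    simp only [Pi.div_apply]
    gcongr
    rw [← X_heat_one_zero B hn hm (contDiff_trunc hχ hf k) (hasCompactSupport_trunc hs k)]
    exact (le_abs_self _).trans (PiLp.norm_apply_le (grad B (heat B 1 (trunc χ f k)) 0) i)

end Truncation

/-! ### The lower bound and the value at time zero. -/

section LowerBound

variable (B : HTypeAlgebra n m) (hn : 0 < n) (hm : 0 < m)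

include hn hm in
theorem sqrt_le_Kopt_one : (∃ F ∈ ClassC B, ∃ g, grad B F g ≠ 0) ∧
    (Real.sqrt ((3 * (n : ℝ) + 5) / (3 * (n : ℝ) + 1)) : EReal) ≤ Kopt B 1 := by
  set u : Ver m := EuclideanSpace.single ⟨0, hm⟩ 1 with hudef
  have hu : ‖u‖ = 1 := by simp [hudef]
  set i : Fin (2 * n) := ⟨0, by omega⟩
  -- The maximiser of `(a + 1)² / (a² - 2a + 3n + 2)`: with `b = a + 1` the reciprocal is `1 - 4/b +
  -- (3n+5)/b²`, least at `b = (3n+5)/2`.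
  set a : ℝ := (3 * n + 3) / 2 with ha
  have hn0 : (0 : ℝ) < n := by exact_mod_cast hn
  have hk := integrable_heatKernel_one (n := n) (m := m) hn hm
  have hk0 := heatKernel_one_nonneg (n := n) (m := m) hn hm
  obtain ⟨hXI, hX⟩ := integral_X_witness B hn hm hu i a
  obtain ⟨hHI, hH⟩ := integral_XHat_witness B hn hm hu i a
  obtain ⟨hSI, hS⟩ := integral_norm_grad_witness_sq B hn hm hu i a
  have hgI := integrable_norm_grad_witness B hn hm hu i a
  set D := ∫ g, ‖grad B (witness B u i a) g‖ * heatKernel 1 g with hD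
  -- Comparing `|∇f|` with its `i`-th component gives a positive lower bound, so the denominator
  -- does not vanish.
  have hDlow : a - 1 ≤ D := by
    rw [← hX]
    refine integral_mono hXI hgI fun g => mul_le_mul_of_nonneg_right ?_ (hk0 g)
    exact (le_abs_self _).trans (PiLp.norm_apply_le (grad B (witness B u i a) g) i)
  have hD0 : 0 < D := by
    have : 0 < a - 1 := by rw [ha]; linarith
    linarith
  -- Jensen's inequality, as nonnegativity of the variance of `|∇f|` under the probability density
  -- `p_1`.
  have hD2 : D ^ 2 ≤ a ^ 2 - 2 * a + 3 * n + 2 := by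
    refine le_trans ?_ hS
    have h0 : 0 ≤ ∫ g, (‖grad B (witness B u i a) g‖ - D) ^ 2 * heatKernel 1 g :=
      integral_nonneg fun g => mul_nonneg (sq_nonneg _) (hk0 g)
    have e : (fun g => (‖grad B (witness B u i a) g‖ - D) ^ 2 * heatKernel 1 g) = fun g =>
        ‖grad B (witness B u i a) g‖ ^ 2 * heatKernel 1 g -
        2 * D * (‖grad B (witness B u i a) g‖ * heatKernel 1 g) + D ^ 2 * heatKernel 1 g := by
      ext g; ring
    have e1 := integral_add (hSI.sub (hgI.const_mul (2 * D))) (hk.const_mul (D ^ 2))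
    have e2 := integral_sub hSI (hgI.const_mul (2 * D))
    rw [integral_const_mul, integral_heatKernel_one hn hm] at e1
    rw [integral_const_mul, ← hD] at e2
    simp only [Pi.sub_apply] at e1 e2
    rw [e, e1, e2] at h0
    linarith
  obtain ⟨h1, h2⟩ := le_Kopt_one B hn hm (contDiff_witness B (u := u) i a) i
    (integrable_witness B hn hm hu i a) hHI hgI hD0
  refine ⟨h1, le_trans ?_ h2⟩
  rw [EReal.coe_le_coe_iff, hH, ← hD]
  have ha1 : 0 ≤ a + 1 := by rw [ha]; linarith
  refine Real.sqrt_le_iff.2 ⟨by positivity, ?_⟩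
  rw [div_pow, div_le_div_iff₀ (by positivity) (by positivity)]
  calc (3 * (n : ℝ) + 5) * D ^ 2 ≤ (3 * n + 5) * (a ^ 2 - 2 * a + 3 * n + 2) := by gcongr
    _ = (a + 1) ^ 2 * (3 * n + 1) := by rw [ha]; ring

/-- Every admissible ratio is a number divided by itself. The hypothesis keeps the set nonempty,
since the supremum of the empty set would be `⊥`. -/
theorem Kopt_zero (h : ∃ F ∈ ClassC B, ∃ g, grad B F g ≠ 0) : Kopt B 0 = 1 := by
  have h0 : ∀ F : Grp n m → ℝ, heat B 0 F = F := fun F => by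
    ext g; simp [heat]
  unfold Kopt
  simp only [h0]
  apply le_antisymm
  · refine sSup_le ?_
    rintro _ ⟨f, -, g, hne, rfl⟩
    rw [div_self hne, EReal.coe_one]
  · obtain ⟨F, hF, g, hg⟩ := h
    have hne : ‖grad B F g‖ ≠ 0 := norm_ne_zero_iff.2 hg
    exact le_sSup ⟨F, hF, g, hne, by rw [div_self hne, EReal.coe_one]⟩

end LowerBound

end HType

end

theorem mainTheorem3 (n m : ℕ) (hn : 0 < n) (hm : 0 < m) (B : HType.HTypeAlgebra n m) :
    HType.Kopt B 0 = 1 ∧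
    (∃ K : EReal, 1 < K ∧
      (Real.sqrt ((3 * (n : ℝ) + 5) / (3 * (n : ℝ) + 1)) : EReal) ≤ K ∧
      ∀ t : ℝ, 0 < t → HType.Kopt B t = K) ∧
    ¬ ContinuousWithinAt (HType.Kopt B) (Set.Ici 0) 0 := by
  obtain ⟨hne, hK⟩ := HType.sqrt_le_Kopt_one B hn hm
  have h0 := HType.Kopt_zero B hne
  have h1 : 1 < HType.Kopt B 1 := by
    refine lt_of_lt_of_le ?_ hK
    rw [← EReal.coe_one, EReal.coe_lt_coe_iff]
    apply Real.lt_sqrt_of_sq_lt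
    rw [one_pow, lt_div_iff₀ (by positivity)]
    linarith
  have ht : ∀ t : ℝ, 0 < t → HType.Kopt B t = HType.Kopt B 1 := fun t ht =>
    HType.Kopt_eq_Kopt_one B ht
  refine ⟨h0, ⟨HType.Kopt B 1, h1, hK, ht⟩, fun hc => ?_⟩
  -- Continuity would force the limit from the right to be `1`, while the function is constant and
  -- larger than `1` there.
  have hlim : Tendsto (HType.Kopt B) (𝓝[>] 0) (𝓝 1) := by
    rw [← h0]
    exact hc.mono_left (nhdsWithin_mono _ Set.Ioi_subset_Ici_self)
  have hconst : Tendsto (HType.Kopt B) (𝓝[>] 0) (𝓝 (HType.Kopt B 1)) :=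
    tendsto_const_nhds.congr' (eventually_mem_nhdsWithin.mono fun t h => (ht t h).symm)
  exact h1.ne (tendsto_nhds_unique hlim hconst)
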